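/- Let $\alpha_1,\alpha_2\in(0,1]$, let $\nu=\min\{\alpha_1,\alpha_2\}$ and $l(\alpha)=\alpha_1+\alpha_2$, let $A=(a_{ij})\in\mathbb R^{2\times 2}$, and put $$Q(s)=s^{\alpha_1+\alpha_2}-a_{11}s^{\alpha_2}-a_{22}s^{\alpha_1}+\det A ,\qquad s\in\mathbb C,$$ with principal branches of the powers (and $0^{\gamma}=0$ for $\gamma>0$). Assume that $Q(s)\neq 0$ for every $s\in\mathbb C$ with $\operatorname{Re}s\ge 0$. By the inverse Laplace transform $\mathcal L^{-1}\{F\}$ of a function $F$ we mean a continuous function $f:(0,\infty)\to\mathbb C$ for which there is $\sigma\in\mathbb R$ such that, for all $s$ with $\operatorname{Re}s>\sigma$, the integral $\int_0^\infty e^{-st}f(t)\,dt$ converges absolutely and equals $F(s)$. Then for every $\lambda\in\{0,\alpha_1,\alpha_2\}$ and every $\beta\in\{\alpha_1,\alpha_2,l(\alpha)\}$ the inverse Laplace transforms $$\mathcal R^\lambda=\mathcal L^{-1}\left\{\frac{s^{l(\alpha)-\lambda}}{s\,Q(s)}\right\},\qquad \mathcal S^\beta=\mathcal L^{-1}\left\{\frac{s^{l(\alpha)-\beta}}{Q(s)}\right\}$$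 exist, and any such functions satisfy $$\mathcal R^\lambda(t)=O(t^{-\nu})\ \text{ and }\ \mathcal S^\beta(t)=O(t^{-\nu-1})\quad\text{as }t\to\infty,\qquad \mathcal S^\beta(t)=O(t^{\nu-1})\quad\text{as }t\to0^+,$$ $$\int_0^\infty|\mathcal S^\beta(t)|\,dt<\infty .$$ -/

import Mathlib

open Set Filter Topology MeasureTheory Asymptotics

/-- `f` is the inverse Laplace transform of `F`: it is continuous on `(0, ∞)`, and on some right
half-plane `Re s > σ` its Laplace integral converges absolutely and equals `F s`.
The values of `f` on `(-∞, 0]` are irrelevant. -/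
def IsInverseLaplace (F : ℂ → ℂ) (f : ℝ → ℂ) : Prop :=
  ContinuousOn f (Ioi 0) ∧
    ∃ σ : ℝ, ∀ s : ℂ, σ < s.re →
      IntegrableOn (fun t : ℝ => Complex.exp (-(s * (t : ℂ))) * f t) (Ioi 0) ∧
        ∫ t in Ioi (0 : ℝ), Complex.exp (-(s * (t : ℂ))) * f t = F s

/-- The characteristic function
`Q(s) = s ^ (α₁ + α₂) - a₁₁ s ^ α₂ - a₂₂ s ^ α₁ + det A`, with principal branches of the powers. -/
noncomputable def charQ (α₁ α₂ : ℝ) (A : Matrix (Fin 2) (Fin 2) ℝ) (s : ℂ) : ℂ :=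
  s ^ ((α₁ + α₂ : ℝ) : ℂ) - (A 0 0 : ℂ) * s ^ (α₂ : ℂ) - (A 1 1 : ℂ) * s ^ (α₁ : ℂ)
    + (A.det : ℂ)

/-- The Laplace image `s ^ (l(α) - lam) / (s Q(s))` of `R^lam`, where `l(α) = α₁ + α₂`. -/
noncomputable def imageR (α₁ α₂ : ℝ) (A : Matrix (Fin 2) (Fin 2) ℝ) (lam : ℝ) (s : ℂ) : ℂ :=
  s ^ ((α₁ + α₂ - lam : ℝ) : ℂ) / (s * charQ α₁ α₂ A s)

/-- The Laplace image `s ^ (l(α) - β) / Q(s)` of `S^β`, where `l(α) = α₁ + α₂`. -/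
noncomputable def imageS (α₁ α₂ : ℝ) (A : Matrix (Fin 2) (Fin 2) ℝ) (β : ℝ) (s : ℂ) : ℂ :=
  s ^ ((α₁ + α₂ - β : ℝ) : ℂ) / charQ α₁ α₂ A s

/-! Since `Q` is continuous on the closed right half-plane, has no zero there and grows like `|z| ^
(α₁ + α₂)`, compactness gives `|Q| ≥ c max(1, |z| ^ (α₁ + α₂))` on a slightly wider sector `Re z ≥
-η |z|` (`exists_norm_charQ_ge`). The images are holomorphic there, so the Bromwich line can be bent
onto the two bounding rays, where `exp (z t)` decays. The inverse is defined directly as that ray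
integral; Fubini and Cauchy's formula on the sector show that its Laplace transform is `F`
(`SectorBound.isInverseLaplace`). Fourier inversion makes the inverse unique, so bounds for this one
function suffice.

On the rays, `|F z| ≤ C |z| ^ q` with `q > -1` gives `O(t ^ (-q - 1))` for all `t > 0`. The two
lower bounds for `Q` allow a range of `q` for the same image. For `R` take `q = ν - 1`; for `S` take
`q = ν` at infinity and `q = -ν` at zero.

Two cases need a correction. For `β = α₁ + α₂` the image tends to `1 / det A ≠ 0` at the origin, but
a constant contributes nothing to the contour integral, so it may be subtracted. For `ν = 1` the
exponent `-ν` is not admissible; then both orders are `1`, and `S` is bounded by comparing `z / Q`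
with `1 / (z + 1)`, the transform of `exp (-t)`, or by integrating `1 / Q` absolutely. Integrability
of `S` follows from the two power bounds. -/

/-! ### Uniqueness of the inverse Laplace transform -/

theorem IsInverseLaplace.eqOn {F : ℂ → ℂ} {f g : ℝ → ℂ} (hf : IsInverseLaplace F f)
    (hg : IsInverseLaplace F g) : EqOn f g (Ioi 0) := by
  obtain ⟨hfc, σ₁, h₁⟩ := hf
  obtain ⟨hgc, σ₂, h₂⟩ := hg
  set σ : ℝ := max σ₁ σ₂ + 1 with hσ
  have hσ₁ : σ₁ < σ := by have := le_max_left σ₁ σ₂; linarith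
  have hσ₂ : σ₂ < σ := by have := le_max_right σ₁ σ₂; linarith
  set h : ℝ → ℂ := (Ioi (0 : ℝ)).indicator
    (fun t => Complex.exp (-((σ : ℂ) * (t : ℂ))) * (f t - g t)) with hh
  have hint : Integrable h := by
    rw [hh, integrable_indicator_iff measurableSet_Ioi]
    have := ((h₁ σ (by simpa using hσ₁)).1).sub ((h₂ σ (by simpa using hσ₂)).1)
    refine this.congr (Eventually.of_forall fun t => ?_)
    simp [mul_sub]
  -- At frequency `ξ` this is the difference of the two Laplace integrals at `σ + 2πiξ`, both equal
  -- to `F`.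
  have hF : FourierTransform.fourier h = 0 := by
    funext ξ
    rw [Real.fourier_real_eq_integral_exp_smul]
    set s : ℂ := σ + 2 * Real.pi * ξ * Complex.I with hs
    have hsre : s.re = σ := by simp [hs]
    obtain ⟨i₁, e₁⟩ := h₁ s (by rw [hsre]; exact hσ₁)
    obtain ⟨i₂, e₂⟩ := h₂ s (by rw [hsre]; exact hσ₂)
    have : (fun v : ℝ => Complex.exp (↑(-2 * Real.pi * v * ξ) * Complex.I) • h v) =
        (Ioi (0 : ℝ)).indicator (fun t : ℝ => Complex.exp (-(s * (t : ℂ))) * f t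
          - Complex.exp (-(s * (t : ℂ))) * g t) := by
      funext t
      by_cases ht : t ∈ Ioi (0 : ℝ)
      · simp only [hh, indicator_of_mem ht, smul_eq_mul]
        rw [← mul_assoc, ← Complex.exp_add, ← mul_sub]
        congr 2
        rw [hs]
        push_cast
        ring
      · simp [hh, indicator_of_notMem ht]
    rw [this, integral_indicator measurableSet_Ioi, integral_sub i₁ i₂, e₁, e₂]
    simp
  intro t ht
  have hcont : ContinuousAt h t := by
    have hc : ContinuousAt (fun t : ℝ => Complex.exp (-((σ : ℂ) * (t : ℂ))) * (f t - g t)) t := by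
      have h1 := hfc.continuousAt (Ioi_mem_nhds ht)
      have h2 := hgc.continuousAt (Ioi_mem_nhds ht)
      have h3 : Continuous (fun t : ℝ => Complex.exp (-((σ : ℂ) * (t : ℂ)))) := by fun_prop
      exact h3.continuousAt.mul (h1.sub h2)
    refine hc.congr ?_
    filter_upwards [Ioi_mem_nhds ht] with u hu
    simp only [hh, indicator_of_mem hu]
  have hinv := hint.fourierInv_fourier_eq (by rw [hF]; exact integrable_zero _ _ _) hcont
  rw [hF] at hinv
  have h0 : h t = 0 := by
    rw [← hinv]
    simp [Real.fourierInv_eq]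
  simp only [hh, indicator_of_mem ht, mul_eq_zero, Complex.exp_ne_zero, false_or] at h0
  exact sub_eq_zero.mp h0

/-! ### Laplace-type integrals along a ray -/

/-- The Laplace-type integral `∫₀^∞ exp (ω r t) G r dr` along the ray through `ω`. -/
noncomputable def rayIntegral (ω : ℂ) (G : ℝ → ℂ) (t : ℝ) : ℂ :=
  ∫ r in Ioi (0 : ℝ), Complex.exp (ω * ((r : ℂ) * (t : ℂ))) * G r

theorem norm_exp_ray (ω : ℂ) (r t : ℝ) :
    ‖Complex.exp (ω * ((r : ℂ) * (t : ℂ)))‖ = Real.exp (-(-ω.re * t * r)) := by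
  rw [Complex.norm_exp]
  congr 1
  simp
  ring

theorem integrableOn_rpow_mul_exp_neg {q k : ℝ} (hq : -1 < q) (hk : 0 < k) :
    IntegrableOn (fun r : ℝ => r ^ q * Real.exp (-(k * r))) (Ioi 0) := by
  have := integrableOn_rpow_mul_exp_neg_mul_rpow (p := 1) hq one_pos hk
  simpa using this

section Ray

variable {ω : ℂ} {G : ℝ → ℂ} {C q : ℝ}

theorem aestronglyMeasurable_ray (hG : ContinuousOn G (Ioi 0)) (t : ℝ) :
    AEStronglyMeasurable (fun r : ℝ => Complex.exp (ω * ((r : ℂ) * (t : ℂ))) * G r)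
      (volume.restrict (Ioi 0)) := by
  refine ContinuousOn.aestronglyMeasurable ?_ measurableSet_Ioi
  exact (Continuous.continuousOn (by fun_prop)).mul hG

theorem norm_ray_le (hb : ∀ r, 0 < r → ‖G r‖ ≤ C * r ^ q) {r : ℝ} (hr : 0 < r) (t : ℝ) :
    ‖Complex.exp (ω * ((r : ℂ) * (t : ℂ))) * G r‖ ≤
      C * (r ^ q * Real.exp (-(-ω.re * t * r))) := by
  rw [norm_mul, norm_exp_ray]
  nlinarith [hb r hr, Real.exp_pos (-(-ω.re * t * r))]

theorem integrableOn_ray (hω : ω.re < 0) (hG : ContinuousOn G (Ioi 0)) (hq : -1 < q)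
    (hb : ∀ r, 0 < r → ‖G r‖ ≤ C * r ^ q) {t : ℝ} (ht : 0 < t) :
    IntegrableOn (fun r : ℝ => Complex.exp (ω * ((r : ℂ) * (t : ℂ))) * G r) (Ioi 0) := by
  refine Integrable.mono' ((integrableOn_rpow_mul_exp_neg hq
    (mul_pos (neg_pos.mpr hω) ht)).const_mul C) (aestronglyMeasurable_ray hG t) ?_
  exact (ae_restrict_iff' measurableSet_Ioi).mpr (ae_of_all _ fun r hr => norm_ray_le hb hr t)

/-- The majorant is a Gamma integral, and scaling `r` by `t` produces the power. No upper bound on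
`q` is needed, since the exponential handles large `r`. -/
theorem norm_rayIntegral_le (hω : ω.re < 0) (hq : -1 < q)
    (hb : ∀ r, 0 < r → ‖G r‖ ≤ C * r ^ q) :
    ∃ K, ∀ t, 0 < t → ‖rayIntegral ω G t‖ ≤ K * t ^ (-q - 1) := by
  refine ⟨C * ((1 / -ω.re) ^ (q + 1) * Real.Gamma (q + 1)), fun t ht => ?_⟩
  have hk : 0 < -ω.re * t := mul_pos (neg_pos.mpr hω) ht
  calc ‖rayIntegral ω G t‖
      ≤ ∫ r in Ioi (0 : ℝ), C * (r ^ q * Real.exp (-(-ω.re * t * r))) :=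
        norm_integral_le_of_norm_le ((integrableOn_rpow_mul_exp_neg hq hk).const_mul C)
          ((ae_restrict_iff' measurableSet_Ioi).mpr
            (ae_of_all _ fun r hr => norm_ray_le hb hr t))
    _ = C * ((1 / (-ω.re * t)) ^ (q + 1) * Real.Gamma (q + 1)) := by
        have := Real.integral_rpow_mul_exp_neg_mul_Ioi (a := q + 1) (by linarith) hk
        rw [integral_const_mul, ← this]
        simp
    _ = _ := by
        have h1 : 1 / (-ω.re * t) = (1 / -ω.re) * t⁻¹ := by
          field_simp
        have h2 : (0 : ℝ) ≤ 1 / -ω.re := by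
          have := neg_pos.mpr hω
          positivity
        rw [h1, Real.mul_rpow h2 (by positivity), Real.inv_rpow ht.le, ← Real.rpow_neg ht.le,
          show -(q + 1) = -q - 1 by ring]
        ring

/-- Replaces the power bound in the borderline case `q = -1`. -/
theorem norm_rayIntegral_le_of_integrableOn (hω : ω.re < 0) {b : ℝ → ℝ}
    (hb : ∀ r, 0 < r → ‖G r‖ ≤ b r) (hbi : IntegrableOn b (Ioi 0)) :
    ∃ K, ∀ t, 0 < t → ‖rayIntegral ω G t‖ ≤ K := by
  refine ⟨∫ r in Ioi (0 : ℝ), b r, fun t ht => ?_⟩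
  refine norm_integral_le_of_norm_le hbi
    ((ae_restrict_iff' measurableSet_Ioi).mpr (ae_of_all _ fun r (hr : 0 < r) => ?_))
  rw [norm_mul, norm_exp_ray]
  have hk : 0 < -ω.re * t * r := mul_pos (mul_pos (neg_pos.mpr hω) ht) hr
  have h1 : Real.exp (-(-ω.re * t * r)) ≤ 1 := Real.exp_le_one_iff.mpr (by linarith)
  calc _ ≤ 1 * ‖G r‖ := by gcongr
    _ ≤ b r := by rw [one_mul]; exact hb r hr

theorem continuousOn_rayIntegral (hω : ω.re < 0) (hG : ContinuousOn G (Ioi 0)) (hq : -1 < q)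
    (hb : ∀ r, 0 < r → ‖G r‖ ≤ C * r ^ q) : ContinuousOn (rayIntegral ω G) (Ioi 0) := by
  intro t (ht : 0 < t)
  refine ContinuousAt.continuousWithinAt ?_
  have hk : 0 < -ω.re * (t / 2) := mul_pos (neg_pos.mpr hω) (by linarith)
  have hC : 0 ≤ C := by
    have := (norm_nonneg _).trans (hb 1 one_pos)
    simpa using this
  refine continuousAt_of_dominated
    (bound := fun r => C * (r ^ q * Real.exp (-(-ω.re * (t / 2) * r))))
    (Eventually.of_forall fun u => aestronglyMeasurable_ray hG u) ?_
    ((integrableOn_rpow_mul_exp_neg hq hk).const_mul C)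
    (ae_of_all _ fun r => by fun_prop)
  filter_upwards [Ioi_mem_nhds (show t / 2 < t by linarith)] with u (hu : t / 2 < u)
  refine (ae_restrict_iff' measurableSet_Ioi).mpr (ae_of_all _ fun r (hr : 0 < r) => ?_)
  refine (norm_ray_le hb hr u).trans ?_
  have : -ω.re * (t / 2) * r ≤ -ω.re * u * r := by
    have := neg_pos.mpr hω
    gcongr
  gcongr

/-- The majorant for Fubini and for the Cauchy integrals: `-1 < q` serves the origin, `q < 0` serves
infinity. -/
theorem integrableOn_rpow_div_add {k m : ℝ} (hk : 0 < k) (hm : 0 < m) (hq : -1 < q) (hq' : q < 0) :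
    IntegrableOn (fun r : ℝ => r ^ q / (k + m * r)) (Ioi 0) := by
  have hmeas : ∀ s ⊆ Ioi (0 : ℝ), MeasurableSet s →
      AEStronglyMeasurable (fun r : ℝ => r ^ q / (k + m * r)) (volume.restrict s) := by
    intro s hs hsm
    refine ContinuousOn.aestronglyMeasurable (fun r hr => ?_) hsm
    have hr : 0 < r := hs hr
    refine ContinuousAt.continuousWithinAt (ContinuousAt.div ?_ (by fun_prop) (by positivity))
    exact Real.continuousAt_rpow_const _ _ (Or.inl hr.ne')
  rw [← Ioc_union_Ioi_eq_Ioi (zero_le_one (α := ℝ)), integrableOn_union]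
  constructor
  · have h := (intervalIntegral.intervalIntegrable_rpow' (a := 0) (b := 1) hq)
    rw [intervalIntegrable_iff_integrableOn_Ioc_of_le zero_le_one] at h
    refine Integrable.mono' (h.const_mul k⁻¹)
      (hmeas _ (fun x hx => hx.1) measurableSet_Ioc) ?_
    refine (ae_restrict_iff' measurableSet_Ioc).mpr (ae_of_all _ fun r hr => ?_)
    have hr : 0 < r := hr.1
    rw [Real.norm_of_nonneg (by positivity), div_eq_inv_mul]
    gcongr
    nlinarith [mul_pos hm hr]
  · have h := (integrableOn_Ioi_rpow_of_lt (a := q - 1) (by linarith) (one_pos (α := ℝ)))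
    refine Integrable.mono' (h.const_mul m⁻¹)
      (hmeas _ (fun x (hx : 1 < x) => one_pos.trans hx) measurableSet_Ioi) ?_
    refine (ae_restrict_iff' measurableSet_Ioi).mpr (ae_of_all _ fun r (hr : 1 < r) => ?_)
    have hr : 0 < r := by linarith
    rw [Real.norm_of_nonneg (by positivity), Real.rpow_sub_one hr.ne', ← div_eq_inv_mul, div_div]
    gcongr
    nlinarith [mul_pos hm hr]

theorem norm_exp_laplace_ray (s : ℂ) (t r : ℝ) :
    ‖Complex.exp (-(s * (t : ℂ))) * (Complex.exp (ω * ((r : ℂ) * (t : ℂ))) * G r)‖ =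
      Real.exp (-(s.re + -ω.re * r) * t) * ‖G r‖ := by
  rw [norm_mul, norm_mul, norm_exp_ray, Complex.norm_exp, ← mul_assoc, ← Real.exp_add]
  congr 2
  simp
  ring

theorem integrable_laplace_ray (hω : ω.re < 0) (hG : ContinuousOn G (Ioi 0)) (hq : -1 < q)
    (hq' : q < 0) (hb : ∀ r, 0 < r → ‖G r‖ ≤ C * r ^ q) {s : ℂ} (hs : 0 < s.re) :
    Integrable (Function.uncurry fun t r : ℝ =>
      Complex.exp (-(s * (t : ℂ))) * (Complex.exp (ω * ((r : ℂ) * (t : ℂ))) * G r))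
      ((volume.restrict (Ioi (0 : ℝ))).prod (volume.restrict (Ioi (0 : ℝ)))) := by
  have hm : AEStronglyMeasurable (Function.uncurry fun t r : ℝ =>
      Complex.exp (-(s * (t : ℂ))) * (Complex.exp (ω * ((r : ℂ) * (t : ℂ))) * G r))
      ((volume.restrict (Ioi (0 : ℝ))).prod (volume.restrict (Ioi (0 : ℝ)))) := by
    rw [Measure.prod_restrict]
    refine ContinuousOn.aestronglyMeasurable ?_ (measurableSet_Ioi.prod measurableSet_Ioi)
    have h1 : ContinuousOn (fun p : ℝ × ℝ => G p.2) (Ioi 0 ×ˢ Ioi 0) :=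
      hG.comp continuousOn_snd fun p hp => hp.2
    have h2 : Continuous fun p : ℝ × ℝ => Complex.exp (-(s * (p.1 : ℂ))) := by fun_prop
    have h3 : Continuous fun p : ℝ × ℝ => Complex.exp (ω * ((p.2 : ℂ) * (p.1 : ℂ))) := by fun_prop
    exact h2.continuousOn.mul (h3.continuousOn.mul h1)
  have hpos : ∀ r : ℝ, 0 < r → 0 < s.re + -ω.re * r := fun r hr =>
    add_pos hs (mul_pos (neg_pos.mpr hω) hr)
  rw [integrable_prod_iff' hm]
  constructor
  · refine (ae_restrict_iff' measurableSet_Ioi).mpr (ae_of_all _ fun r (hr : 0 < r) => ?_)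
    refine (integrable_norm_iff (Continuous.aestronglyMeasurable ?_)).mp ?_
    · simp only [Function.uncurry_apply_pair]
      fun_prop
    · simp only [Function.uncurry_apply_pair, norm_exp_laplace_ray]
      exact (exp_neg_integrableOn_Ioi 0 (hpos r hr)).mul_const _
  · simp only [Function.uncurry_apply_pair, norm_exp_laplace_ray]
    -- Integrating the norm in `t` first leaves `‖G r‖ / (Re s - r Re ω)`.
    refine Integrable.mono' ((integrableOn_rpow_div_add hs (neg_pos.mpr hω) hq hq').const_mul C)
      ?_ ?_
    · have := hm.norm.prod_swap.integral_prod_right'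
      simpa only [Function.comp_apply, Prod.swap_prod_mk, Function.uncurry_apply_pair,
        Prod.fst_swap, Prod.snd_swap, norm_exp_laplace_ray] using this
    · refine (ae_restrict_iff' measurableSet_Ioi).mpr (ae_of_all _ fun r (hr : 0 < r) => ?_)
      have := hpos r hr
      have h3 := hb r hr
      rw [integral_mul_const, integral_exp_mul_Ioi (by linarith), mul_zero, Real.exp_zero,
        neg_div_neg_eq, Real.norm_of_nonneg (by positivity)]
      calc _ ≤ 1 / (s.re + -ω.re * r) * (C * r ^ q) := by gcongr
        _ = _ := by ring

theorem integrableOn_laplace_rayIntegral (hω : ω.re < 0) (hG : ContinuousOn G (Ioi 0))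
    (hq : -1 < q) (hq' : q < 0) (hb : ∀ r, 0 < r → ‖G r‖ ≤ C * r ^ q) {s : ℂ} (hs : 0 < s.re) :
    IntegrableOn (fun t : ℝ => Complex.exp (-(s * (t : ℂ))) * rayIntegral ω G t) (Ioi 0) := by
  have := (integrable_laplace_ray hω hG hq hq' hb hs).integral_prod_left
  simp only [Function.uncurry_apply_pair, integral_const_mul] at this
  exact this

theorem integral_laplace_rayIntegral (hω : ω.re < 0) (hG : ContinuousOn G (Ioi 0))
    (hq : -1 < q) (hq' : q < 0) (hb : ∀ r, 0 < r → ‖G r‖ ≤ C * r ^ q) {s : ℂ} (hs : 0 < s.re) :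
    ∫ t in Ioi (0 : ℝ), Complex.exp (-(s * (t : ℂ))) * rayIntegral ω G t =
      ∫ r in Ioi (0 : ℝ), G r / (s - r * ω) := by
  simp only [rayIntegral, ← integral_const_mul]
  rw [integral_integral_swap (integrable_laplace_ray hω hG hq hq' hb hs)]
  refine setIntegral_congr_fun measurableSet_Ioi fun r (hr : 0 < r) => ?_
  have h : ∀ t : ℝ, Complex.exp (-(s * (t : ℂ))) * (Complex.exp (ω * ((r : ℂ) * (t : ℂ))) * G r) =
      Complex.exp ((r * ω - s) * t) * G r := by
    intro t
    rw [← mul_assoc, ← Complex.exp_add]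
    congr 2
    ring
  have hre : ((r : ℂ) * ω - s).re < 0 := by
    simp only [Complex.sub_re, Complex.re_ofReal_mul]
    nlinarith
  simp only [h, integral_mul_const]
  rw [integral_exp_mul_complex_Ioi hre]
  simp only [Complex.ofReal_zero, mul_zero, Complex.exp_zero]
  rw [← neg_sub s, neg_div_neg_eq]
  ring

theorem integrableOn_div_sub_ray (hω : ω.re < 0) (hG : ContinuousOn G (Ioi 0))
    (hq : -1 < q) (hq' : q < 0) (hb : ∀ r, 0 < r → ‖G r‖ ≤ C * r ^ q) {s : ℂ} (hs : 0 < s.re) :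
    IntegrableOn (fun r : ℝ => G r / (s - r * ω)) (Ioi 0) := by
  have hre : ∀ r : ℝ, 0 < r → s.re + -ω.re * r ≤ ‖s - r * ω‖ := fun r hr => by
    refine le_trans (le_of_eq ?_) (Complex.re_le_norm _)
    simp
    ring
  have hpos : ∀ r : ℝ, 0 < r → 0 < s.re + -ω.re * r := fun r hr =>
    add_pos hs (mul_pos (neg_pos.mpr hω) hr)
  refine Integrable.mono' ((integrableOn_rpow_div_add hs (neg_pos.mpr hω) hq hq').const_mul C)
    (ContinuousOn.aestronglyMeasurable (hG.div (by fun_prop) fun r hr h0 => ?_)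
      measurableSet_Ioi) ?_
  · have := hre r hr
    rw [h0, norm_zero] at this
    linarith [hpos r hr]
  · refine (ae_restrict_iff' measurableSet_Ioi).mpr (ae_of_all _ fun r (hr : 0 < r) => ?_)
    rw [norm_div, ← mul_div_assoc]
    have h1 := hpos r hr
    have h2 := (norm_nonneg _).trans (hb r hr)
    exact div_le_div₀ h2 (hb r hr) h1 (hre r hr)

end Ray

/-! ### The sector -/

/-- The closed sector `|arg z| ≤ arccos (-η)` without its vertex. -/
def sector (η : ℝ) : Set ℂ := {z | z ≠ 0 ∧ -η * ‖z‖ ≤ z.re}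

theorem mem_sector_of_re_pos {η : ℝ} (hη : 0 ≤ η) {z : ℂ} (hz : 0 < z.re) : z ∈ sector η :=
  ⟨fun h => by simp [h] at hz, by nlinarith [mul_nonneg hη (norm_nonneg z)]⟩

theorem sector_subset_slitPlane {η : ℝ} (hη : η < 1) : sector η ⊆ Complex.slitPlane := by
  rintro z ⟨hz0, hz⟩
  rw [Complex.mem_slitPlane_iff]
  by_contra! h
  have hzr : z = (z.re : ℂ) := Complex.ext rfl (by simp [h.2])
  have hn : ‖z‖ = -z.re := by
    rw [hzr, Complex.norm_real, Real.norm_of_nonpos h.1, Complex.ofReal_re]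
  have : 0 < ‖z‖ := norm_pos_iff.mpr hz0
  nlinarith

theorem norm_add_one_ge {η : ℝ} (hη0 : 0 ≤ η) (hη : η < 1) {z : ℂ} (hz : z ∈ sector η) :
    (1 - η) / 2 * (1 + ‖z‖) ≤ ‖z + 1‖ := by
  have h1 : ‖z + 1‖ ^ 2 = ‖z‖ ^ 2 + 2 * z.re + 1 := by
    rw [Complex.sq_norm, Complex.sq_norm, Complex.normSq_apply, Complex.normSq_apply]
    simp
    ring
  refine le_of_sq_le_sq ?_ (norm_nonneg _)
  rw [h1]
  have h2 := hz.2
  -- With `x = ‖z‖`: `x² - 2ηx + 1 = (1 - η)/2 (1 + x)² + (1 + η)/2 (1 - x)²`, and `(1 - η)/2`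
  -- dominates its own square.
  nlinarith [sq_nonneg (‖z‖ - 1), norm_nonneg z, mul_nonneg hη0 (sub_nonneg.mpr hη.le),
    mul_nonneg (mul_nonneg hη0 (sub_nonneg.mpr hη.le)) (sq_nonneg (‖z‖ + 1)),
    mul_nonneg hη0 (sq_nonneg (‖z‖ + 1)), mul_nonneg hη0 (sq_nonneg (‖z‖ - 1)),
    mul_nonneg (sub_nonneg.mpr hη.le) (sq_nonneg (‖z‖ - 1))]

theorem inv_one_add_le_rpow {r q : ℝ} (hr : 0 < r) (hq : -1 ≤ q) (hq' : q ≤ 0) :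
    (1 + r)⁻¹ ≤ r ^ q := by
  rcases le_total r 1 with h | h
  · calc (1 + r)⁻¹ ≤ 1 := inv_le_one_of_one_le₀ (by linarith)
      _ ≤ r ^ q := Real.one_le_rpow_of_pos_of_le_one_of_nonpos hr h hq'
  · calc (1 + r)⁻¹ ≤ r⁻¹ := by gcongr; linarith
      _ = r ^ (-1 : ℝ) := (Real.rpow_neg_one r).symm
      _ ≤ r ^ q := Real.rpow_le_rpow_of_exponent_le h hq

/-! ### Cauchy's theorem and Cauchy's formula on the sector -/

/-- Horizontal line integrals over the two sides of a strip agree for a function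
holomorphic in the strip and vanishing at both of its ends. -/
theorem integral_strip_eq {f : ℂ → ℂ} {θ : ℝ} (hθ : 0 ≤ θ) {ψ : ℝ → ℝ}
    (hd : ∀ w : ℂ, |w.im| ≤ θ → DifferentiableAt ℂ f w)
    (hi : Integrable fun x : ℝ => f (x + θ * Complex.I))
    (hi' : Integrable fun x : ℝ => f (x + (-θ : ℝ) * Complex.I))
    (htop : Tendsto ψ atTop (𝓝 0)) (hbot : Tendsto ψ atBot (𝓝 0))
    (hbtop : ∀ᶠ x : ℝ in atTop, ∀ y : ℝ, |y| ≤ θ → ‖f (x + y * Complex.I)‖ ≤ ψ x)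
    (hbbot : ∀ᶠ x : ℝ in atBot, ∀ y : ℝ, |y| ≤ θ → ‖f (x + y * Complex.I)‖ ≤ ψ x) :
    ∫ x : ℝ, f (x + θ * Complex.I) = ∫ x : ℝ, f (x + (-θ : ℝ) * Complex.I) := by
  have hvert : ∀ {l : Filter ℝ}, Tendsto ψ l (𝓝 0) →
      (∀ᶠ x : ℝ in l, ∀ y : ℝ, |y| ≤ θ → ‖f (x + y * Complex.I)‖ ≤ ψ x) →
      Tendsto (fun x : ℝ => ∫ y in (-θ)..θ, f (x + y * Complex.I)) l (𝓝 0) := by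
    intro l hl hb
    refine squeeze_zero_norm' (a := fun x => ψ x * |θ - -θ|) ?_ (by simpa using hl.mul_const _)
    filter_upwards [hb] with x hx
    refine intervalIntegral.norm_integral_le_of_norm_le_const fun y hy => hx y ?_
    rw [uIoc_of_le (by linarith)] at hy
    exact abs_le.mpr ⟨hy.1.le, hy.2⟩
  have hrect : ∀ n : ℝ, ((∫ x : ℝ in (-n)..n, f (x + (-θ : ℝ) * Complex.I))
      - ∫ x : ℝ in (-n)..n, f (x + θ * Complex.I))
      + Complex.I • (∫ y : ℝ in (-θ)..θ, f (n + y * Complex.I))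
      - Complex.I • (∫ y : ℝ in (-θ)..θ, f ((-n : ℝ) + y * Complex.I)) = 0 := by
    intro n
    have := Complex.integral_boundary_rect_eq_zero_of_differentiableOn f ⟨-n, -θ⟩ ⟨n, θ⟩ ?_
    · simpa using this
    · intro w hw
      refine (hd w ?_).differentiableWithinAt
      have := hw.2
      simp only [mem_preimage] at this
      rw [uIcc_of_le (by linarith)] at this
      exact abs_le.mpr this
  have hlim := (((intervalIntegral_tendsto_integral hi' tendsto_neg_atTop_atBot tendsto_id).sub
    (intervalIntegral_tendsto_integral hi tendsto_neg_atTop_atBot tendsto_id)).add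
    ((hvert htop hbtop).const_smul Complex.I)).sub
    (((hvert hbot hbbot).comp tendsto_neg_atTop_atBot).const_smul Complex.I)
  have h0 := tendsto_nhds_unique hlim (tendsto_const_nhds.congr fun n => (hrect n).symm)
  simp only [smul_zero, add_zero, sub_zero] at h0
  exact (sub_eq_zero.mp h0).symm

theorem exp_image_univ : Real.exp '' univ = Ioi 0 := by
  rw [image_univ, Real.range_exp]

theorem integral_exp_comp (g : ℝ → ℂ) :
    ∫ x : ℝ, (Real.exp x : ℂ) * g (Real.exp x) = ∫ r in Ioi (0 : ℝ), g r := by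
  have := integral_image_eq_integral_abs_deriv_smul (s := univ) MeasurableSet.univ
    (fun x _ => (Real.hasDerivAt_exp x).hasDerivWithinAt) Real.exp_injective.injOn g
  rw [exp_image_univ] at this
  rw [this, Measure.restrict_univ]
  simp [abs_of_pos (Real.exp_pos _)]

theorem integrable_exp_comp {g : ℝ → ℂ} (hg : IntegrableOn g (Ioi 0)) :
    Integrable fun x : ℝ => (Real.exp x : ℂ) * g (Real.exp x) := by
  have := integrableOn_image_iff_integrableOn_abs_deriv_smul (s := univ) MeasurableSet.univ
    (fun x _ => (Real.hasDerivAt_exp x).hasDerivWithinAt) Real.exp_injective.injOn g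
  rw [exp_image_univ, integrableOn_univ] at this
  simpa [abs_of_pos (Real.exp_pos _)] using this.mp hg

/-- The unit vector bounding `sector η` from above. -/
noncomputable def rayDir (η : ℝ) : ℂ := Complex.exp (Real.arccos (-η) * Complex.I)

/-- The unit vector bounding `sector η` from below. -/
noncomputable def rayDirConj (η : ℝ) : ℂ :=
  Complex.exp ((-Real.arccos (-η) : ℝ) * Complex.I)

section Directions

variable {η : ℝ} (hη0 : 0 < η) (hη : η < 1)
include hη0 hη

theorem rayDir_re : (rayDir η).re = -η := by
  rw [rayDir, Complex.exp_ofReal_mul_I_re, Real.cos_arccos (by linarith) (by linarith)]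

theorem rayDirConj_re : (rayDirConj η).re = -η := by
  rw [rayDirConj, Complex.exp_ofReal_mul_I_re, Real.cos_neg,
    Real.cos_arccos (by linarith) (by linarith)]

theorem sin_arccos_neg_pos : 0 < Real.sin (Real.arccos (-η)) := by
  rw [Real.sin_arccos]
  exact Real.sqrt_pos.mpr (by nlinarith)

theorem rayDir_im : 0 < (rayDir η).im := by
  rw [rayDir, Complex.exp_ofReal_mul_I_im]
  exact sin_arccos_neg_pos hη0 hη

theorem rayDirConj_im : (rayDirConj η).im < 0 := by
  rw [rayDirConj, Complex.exp_ofReal_mul_I_im, Real.sin_neg]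
  exact neg_neg_of_pos (sin_arccos_neg_pos hη0 hη)

theorem exp_mem_sector {w : ℂ} (hw : |w.im| ≤ Real.arccos (-η)) : Complex.exp w ∈ sector η := by
  refine ⟨Complex.exp_ne_zero _, ?_⟩
  rw [Complex.norm_exp, Complex.exp_re]
  have h : -η ≤ Real.cos w.im := by
    rw [← Real.cos_abs, ← Real.cos_arccos (x := -η) (by linarith) (by linarith)]
    exact Real.cos_le_cos_of_nonneg_of_le_pi (abs_nonneg _) (Real.arccos_le_pi _) hw
  nlinarith [Real.exp_pos w.re]

end Directions

theorem norm_rayDir (η : ℝ) : ‖rayDir η‖ = 1 := Complex.norm_exp_ofReal_mul_I _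

theorem norm_rayDirConj (η : ℝ) : ‖rayDirConj η‖ = 1 := Complex.norm_exp_ofReal_mul_I _

theorem mul_mem_sector {η : ℝ} {ω : ℂ} (hre : ω.re = -η) (hn : ‖ω‖ = 1) {r : ℝ} (hr : 0 < r) :
    (r : ℂ) * ω ∈ sector η := by
  have h0 : ω ≠ 0 := fun h => by simp [h] at hn
  refine ⟨mul_ne_zero (Complex.ofReal_ne_zero.mpr hr.ne') h0, ?_⟩
  rw [norm_mul, hn, Complex.norm_real, Real.norm_of_nonneg hr.le, Complex.re_ofReal_mul, hre]
  linarith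

/-- Cauchy's theorem on a sector: the integrals along the two bounding rays agree. -/
theorem integral_rayDir_eq {η : ℝ} (hη0 : 0 < η) (hη : η < 1) {H : ℂ → ℂ} {φ : ℝ → ℝ}
    (hd : ∀ z ∈ sector η, DifferentiableAt ℂ H z)
    (hi : IntegrableOn (fun r : ℝ => H (r * rayDir η) * rayDir η) (Ioi 0))
    (hi' : IntegrableOn (fun r : ℝ => H (r * rayDirConj η) * rayDirConj η) (Ioi 0))
    (hzero : Tendsto φ (𝓝[>] 0) (𝓝 0)) (htop : Tendsto φ atTop (𝓝 0))
    (hbzero : ∀ᶠ r in 𝓝[>] (0 : ℝ), ∀ z ∈ sector η, ‖z‖ = r → ‖z * H z‖ ≤ φ r)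
    (hbtop : ∀ᶠ r in atTop, ∀ z ∈ sector η, ‖z‖ = r → ‖z * H z‖ ≤ φ r) :
    ∫ r in Ioi (0 : ℝ), H (r * rayDir η) * rayDir η =
      ∫ r in Ioi (0 : ℝ), H (r * rayDirConj η) * rayDirConj η := by
  have hexp : ∀ x y : ℝ, Complex.exp (x + y * Complex.I) =
      (Real.exp x : ℂ) * Complex.exp (y * Complex.I) := fun x y => by
    rw [Complex.exp_add, Complex.ofReal_exp]
  have hnorm : ∀ x y : ℝ, ‖Complex.exp (x + y * Complex.I)‖ = Real.exp x := fun x y => by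
    rw [Complex.norm_exp]
    simp
  -- The substitution `z = exp w` turns the rays into the edges of the strip `|Im w| ≤ arccos (-η)`;
  -- the Jacobian is why `z * H z` must be small at both ends.
  rw [← integral_exp_comp, ← integral_exp_comp]
  have e₁ : ∀ x : ℝ, (Real.exp x : ℂ) * (H ((Real.exp x : ℝ) * rayDir η) * rayDir η) =
      (fun w => Complex.exp w * H (Complex.exp w)) (x + Real.arccos (-η) * Complex.I) := by
    intro x
    simp only [hexp, ← rayDir.eq_1]
    ring
  have e₂ : ∀ x : ℝ, (Real.exp x : ℂ) * (H ((Real.exp x : ℝ) * rayDirConj η) * rayDirConj η) =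
      (fun w => Complex.exp w * H (Complex.exp w))
        (x + (-Real.arccos (-η) : ℝ) * Complex.I) := by
    intro x
    simp only [hexp, ← rayDirConj.eq_1]
    ring
  have i₁ := integrable_exp_comp hi
  have i₂ := integrable_exp_comp hi'
  simp only [e₁] at i₁ ⊢
  simp only [e₂] at i₂ ⊢
  have hexp0 : Tendsto Real.exp atBot (𝓝[>] 0) :=
    tendsto_nhdsWithin_iff.mpr ⟨Real.tendsto_exp_atBot, Eventually.of_forall Real.exp_pos⟩
  refine integral_strip_eq (f := fun w => Complex.exp w * H (Complex.exp w))
    (ψ := fun x => φ (Real.exp x)) (Real.arccos_nonneg _) (fun w hw => ?_)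
    i₁ i₂ (htop.comp Real.tendsto_exp_atTop) (hzero.comp hexp0) ?_ ?_
  · exact Complex.differentiableAt_exp.mul
      ((hd _ (exp_mem_sector hη0 hη hw)).comp w Complex.differentiableAt_exp)
  · filter_upwards [Real.tendsto_exp_atTop.eventually hbtop] with x hx y hy
    exact hx _ (exp_mem_sector hη0 hη (by simpa using hy)) (hnorm x y)
  · filter_upwards [hexp0.eventually hbzero] with x hx y hy
    exact hx _ (exp_mem_sector hη0 hη (by simpa using hy)) (hnorm x y)

/-- The hypotheses under which `F` is inverted along the boundary of a sector. -/
structure SectorBound (η q C : ℝ) (F : ℂ → ℂ) : Prop where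
  differentiableAt : ∀ z ∈ sector η, DifferentiableAt ℂ F z
  norm_le : ∀ z ∈ sector η, ‖F z‖ ≤ C * ‖z‖ ^ q

namespace SectorBound

variable {η q C : ℝ} {F : ℂ → ℂ}

theorem continuousOn_ray (h : SectorBound η q C F) {ω : ℂ} (hre : ω.re = -η) (hn : ‖ω‖ = 1) :
    ContinuousOn (fun r : ℝ => F (r * ω) * ω) (Ioi 0) := by
  intro r hr
  refine ContinuousAt.continuousWithinAt (ContinuousAt.mul ?_ continuousAt_const)
  exact ContinuousAt.comp (f := fun r : ℝ => (r : ℂ) * ω) (g := F)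
    (h.differentiableAt _ (mul_mem_sector hre hn hr)).continuousAt (by fun_prop)

theorem norm_ray_le (h : SectorBound η q C F) {ω : ℂ} (hre : ω.re = -η) (hn : ‖ω‖ = 1)
    (r : ℝ) (hr : 0 < r) : ‖F (r * ω) * ω‖ ≤ C * r ^ q := by
  have := h.norm_le _ (mul_mem_sector hre hn hr)
  rw [norm_mul (r : ℂ), hn, Complex.norm_real, Real.norm_of_nonneg hr.le, mul_one] at this
  rwa [norm_mul, hn, mul_one]

/-- When `F s = 0` the singularity of `F z / (s - z)` at `s` is removable: up to sign it is `dslope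
F s`, to which Cauchy's theorem on the sector applies. -/
theorem integral_div_sub_eq_of_apply_eq_zero (h : SectorBound η q C F) (hη0 : 0 < η) (hη : η < 1)
    (hq : -1 < q) (hq' : q < 0) {s : ℂ} (hs : 0 < s.re) (hFs : F s = 0) :
    ∫ r in Ioi (0 : ℝ), F (r * rayDir η) * rayDir η / (s - r * rayDir η) =
      ∫ r in Ioi (0 : ℝ), F (r * rayDirConj η) * rayDirConj η / (s - r * rayDirConj η) := by
  have hs0 : 0 < ‖s‖ := norm_pos_iff.mpr fun h => by simp [h] at hs
  have hne : ∀ z, z ≠ s → dslope F s z = -(F z / (s - z)) := fun z hz => by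
    rw [dslope_of_ne _ hz, slope_def_field, hFs, sub_zero, ← neg_sub s z, div_neg]
  have hray : ∀ ω : ℂ, ω.re = -η → ∀ r : ℝ, 0 < r → (r : ℂ) * ω ≠ s := fun ω hω r hr h => by
    rw [← h, Complex.re_ofReal_mul, hω] at hs
    nlinarith
  have key : ∀ ω : ℂ, ω.re = -η → EqOn (fun r : ℝ => dslope F s (r * ω) * ω)
      (fun r : ℝ => -(F (r * ω) * ω / (s - r * ω))) (Ioi 0) := by
    intro ω hω r hr
    simp only [hne _ (hray ω hω r hr)]
    ring
  have hint : ∀ ω : ℂ, ω.re = -η → ‖ω‖ = 1 →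
      IntegrableOn (fun r : ℝ => dslope F s (r * ω) * ω) (Ioi 0) := fun ω hω hn => by
    refine IntegrableOn.congr_fun ?_ (key ω hω).symm measurableSet_Ioi
    exact (integrableOn_div_sub_ray (by rw [hω]; linarith) (h.continuousOn_ray hω hn) hq hq'
      (h.norm_ray_le hω hn) hs).neg
  -- Follows from `|s - z| ≥ ||z| - |s||`. The majorant behaves like `r ^ (q + 1)` at zero and `r ^
  -- q` at infinity, so it vanishes at both ends.
  have hbound : ∀ r : ℝ, r ≠ ‖s‖ → ∀ z ∈ sector η, ‖z‖ = r →
      ‖z * dslope F s z‖ ≤ C * r ^ q * (r / |r - ‖s‖|) := by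
    intro r hr z hz hzr
    have hzs : z ≠ s := fun h => hr (by rw [← hzr, h])
    have h1 : 0 < |r - ‖s‖| := abs_pos.mpr (sub_ne_zero.mpr hr)
    have h2 : |r - ‖s‖| ≤ ‖s - z‖ := by
      rw [← hzr, norm_sub_rev]
      exact abs_norm_sub_norm_le _ _
    have h3 := h.norm_le z hz
    rw [hzr] at h3
    have hr0 : 0 ≤ r := hzr ▸ norm_nonneg z
    have h4 := (norm_nonneg _).trans h3
    rw [hne z hzs, norm_mul, norm_neg, norm_div, hzr]
    calc r * (‖F z‖ / ‖s - z‖) ≤ r * ((C * r ^ q) / |r - ‖s‖|) := by gcongr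
      _ = _ := by ring
  have hmain := integral_rayDir_eq hη0 hη (H := dslope F s)
    (φ := fun r => C * r ^ q * (r / |r - ‖s‖|)) ?_
    (hint _ (rayDir_re hη0 hη) (norm_rayDir η)) (hint _ (rayDirConj_re hη0 hη) (norm_rayDirConj η))
    ?_ ?_ ?_ ?_
  · rw [setIntegral_congr_fun measurableSet_Ioi (key _ (rayDir_re hη0 hη)),
      setIntegral_congr_fun measurableSet_Ioi (key _ (rayDirConj_re hη0 hη)),
      integral_neg, integral_neg] at hmain
    exact neg_injective hmain
  · intro z hz
    by_cases hzs : z = s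
    · have hU : {z : ℂ | 0 < z.re} ∈ 𝓝 s :=
        (isOpen_lt continuous_const Complex.continuous_re).mem_nhds hs
      have := (Complex.differentiableOn_dslope (f := F) hU).mpr fun w hw =>
        (h.differentiableAt w (mem_sector_of_re_pos hη0.le hw)).differentiableWithinAt
      rw [hzs]
      exact this.differentiableAt hU
    · exact (differentiableAt_dslope_of_ne hzs).mpr (h.differentiableAt z hz)
  · have hc : ContinuousAt (fun r : ℝ => C * r ^ (q + 1) / |r - ‖s‖|) 0 := by
      refine ContinuousAt.div (continuousAt_const.mul
        (Real.continuousAt_rpow_const _ _ (Or.inr (by linarith)))) (by fun_prop) ?_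
      simpa using hs0.ne'
    have h0 : Tendsto (fun r : ℝ => C * r ^ (q + 1) / |r - ‖s‖|) (𝓝[>] 0) (𝓝 0) := by
      have := hc.tendsto
      simp only [Real.zero_rpow (by linarith : q + 1 ≠ 0), mul_zero, zero_div] at this
      exact this.mono_left nhdsWithin_le_nhds
    refine h0.congr' ?_
    filter_upwards [self_mem_nhdsWithin] with r (hr : 0 < r)
    rw [Real.rpow_add_one hr.ne']
    ring
  · have h1 : Tendsto (fun r : ℝ => C * r ^ q) atTop (𝓝 0) := by
      have := (tendsto_rpow_neg_atTop (neg_pos.mpr hq')).const_mul C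
      simpa using this
    have h2 : Tendsto (fun r : ℝ => (1 - ‖s‖ / r)⁻¹) atTop (𝓝 1) := by
      have := (tendsto_const_nhds (x := (1 : ℝ))).sub
        ((tendsto_const_nhds (x := ‖s‖)).div_atTop tendsto_id)
      simpa using this.inv₀ (by simp)
    have := h1.mul h2
    rw [zero_mul] at this
    refine this.congr' ?_
    filter_upwards [eventually_gt_atTop ‖s‖] with r hr
    have hr0 : 0 < r := hs0.trans hr
    rw [abs_of_pos (sub_pos.mpr hr)]
    have := (sub_pos.mpr hr).ne'
    field_simp
  · filter_upwards [nhdsWithin_le_nhds (Iio_mem_nhds hs0)] with r (hr : r < ‖s‖)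
    exact hbound r hr.ne
  · filter_upwards [eventually_gt_atTop ‖s‖] with r hr
    exact hbound r hr.ne'

end SectorBound

/-- The comparison function: its pole `-1` lies outside the sector, and its Cauchy integrals are
explicit. -/
theorem sectorBound_inv_add_one {η q : ℝ} (hη0 : 0 ≤ η) (hη : η < 1) (hq : -1 ≤ q) (hq' : q ≤ 0) :
    SectorBound η q (2 / (1 - η)) (fun z => (z + 1)⁻¹) := by
  have hk : 0 < (1 - η) / 2 := by linarith
  have hpos : ∀ z ∈ sector η, 0 < ‖z + 1‖ := fun z hz =>
    (mul_pos hk (by positivity)).trans_le (norm_add_one_ge hη0 hη hz)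
  refine ⟨fun z hz => ?_, fun z hz => ?_⟩
  · exact (differentiableAt_id.add_const 1).inv (norm_pos_iff.mp (hpos z hz))
  · have hz0 : 0 < ‖z‖ := norm_pos_iff.mpr hz.1
    rw [norm_inv]
    calc ‖z + 1‖⁻¹ ≤ ((1 - η) / 2 * (1 + ‖z‖))⁻¹ := by
          gcongr
          exact norm_add_one_ge hη0 hη hz
      _ = 2 / (1 - η) * (1 + ‖z‖)⁻¹ := by rw [mul_inv, inv_div]
      _ ≤ _ := by
          have : 0 ≤ 2 / (1 - η) := (inv_div (1 - η) 2).symm ▸ (inv_pos.mpr hk).le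
          gcongr
          exact inv_one_add_le_rpow hz0 hq hq'

namespace SectorBound

variable {η q C C' : ℝ} {F G : ℂ → ℂ}

theorem sub (hF : SectorBound η q C F) (hG : SectorBound η q C' G) :
    SectorBound η q (C + C') (fun z => F z - G z) := by
  refine ⟨fun z hz => (hF.differentiableAt z hz).sub (hG.differentiableAt z hz), fun z hz => ?_⟩
  rw [add_mul]
  exact (norm_sub_le _ _).trans (add_le_add (hF.norm_le z hz) (hG.norm_le z hz))

theorem const_mul (hF : SectorBound η q C F) (k : ℂ) :
    SectorBound η q (‖k‖ * C) (fun z => k * F z) := by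
  refine ⟨fun z hz => (hF.differentiableAt z hz).const_mul k, fun z hz => ?_⟩
  rw [norm_mul, mul_assoc]
  exact mul_le_mul_of_nonneg_left (hF.norm_le z hz) (norm_nonneg k)

end SectorBound

/-- Partial fractions give a logarithmic primitive whose arguments stay in the slit plane; at
infinity the two terms `log r` cancel. -/
theorem integral_inv_add_one_div_sub {η : ℝ} (hη0 : 0 < η) (hη : η < 1) {ω : ℂ} (hre : ω.re = -η)
    (hn : ‖ω‖ = 1) (him : ω.im ≠ 0) {s : ℂ} (hs : 0 < s.re) :
    ∫ r in Ioi (0 : ℝ), (r * ω + 1)⁻¹ * ω / (s - r * ω) =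
      (Complex.log ω - Complex.log (-ω) + Complex.log s) / (s + 1) := by
  -- Any exponent in `(-1, 0)` would do; it serves only for integrability.
  have hB := sectorBound_inv_add_one (q := -(1 / 2)) hη0.le hη (by norm_num) (by norm_num)
  have hs1 : s + 1 ≠ 0 := fun h => by
    have := congrArg Complex.re h
    simp at this
    linarith
  have hω : ω ∈ Complex.slitPlane := Complex.mem_slitPlane_iff.mpr (Or.inr him)
  have hω' : -ω ∈ Complex.slitPlane := Complex.mem_slitPlane_iff.mpr (Or.inr (by simpa using him))
  have hadd : ∀ r : ℝ, 0 ≤ r → (r : ℂ) * ω + 1 ∈ Complex.slitPlane := by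
    intro r hr
    rcases hr.eq_or_lt with rfl | hr
    · simp
    · exact Complex.mem_slitPlane_iff.mpr (Or.inr (by simp [hr.ne', him]))
  have hsub : ∀ r : ℝ, 0 ≤ r → s - r * ω ∈ Complex.slitPlane := by
    intro r hr
    refine Complex.mem_slitPlane_iff.mpr (Or.inl ?_)
    rw [Complex.sub_re, Complex.re_ofReal_mul, hre]
    nlinarith
  have hder : ∀ r : ℝ, 0 ≤ r → HasDerivAt
      (fun r : ℝ => (Complex.log (r * ω + 1) - Complex.log (s - r * ω)) / (s + 1))
      ((r * ω + 1)⁻¹ * ω / (s - r * ω)) r := by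
    intro r hr
    have h0 : HasDerivAt (fun r : ℝ => (r : ℂ) * ω) ω r := by
      simpa using (Complex.ofRealCLM.hasDerivAt (x := r)).mul_const ω
    have h1 := (h0.add_const 1).clog_real (hadd r hr)
    have h2 := (h0.const_sub s).clog_real (hsub r hr)
    refine ((h1.sub h2).div_const (s + 1)).congr_deriv ?_
    have ha := Complex.slitPlane_ne_zero (hadd r hr)
    have hb := Complex.slitPlane_ne_zero (hsub r hr)
    rw [div_sub_div _ _ ha hb, div_div, inv_mul_eq_div, div_div,
      div_eq_div_iff (mul_ne_zero (mul_ne_zero ha hb) hs1) (mul_ne_zero ha hb)]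
    ring
  have hlim : Tendsto
      (fun r : ℝ => (Complex.log (r * ω + 1) - Complex.log (s - r * ω)) / (s + 1)) atTop
      (𝓝 ((Complex.log ω - Complex.log (-ω)) / (s + 1))) := by
    have hinv : Tendsto (fun r : ℝ => ((r⁻¹ : ℝ) : ℂ)) atTop (𝓝 0) := by
      have := (Complex.continuous_ofReal.tendsto 0).comp tendsto_inv_atTop_zero
      rwa [Complex.ofReal_zero] at this
    have t1 : Tendsto (fun r : ℝ => ω + ((r⁻¹ : ℝ) : ℂ)) atTop (𝓝 ω) := by
      simpa using hinv.const_add ω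
    have t2 : Tendsto (fun r : ℝ => ((r⁻¹ : ℝ) : ℂ) * s - ω) atTop (𝓝 (-ω)) := by
      simpa using (hinv.mul_const s).sub_const ω
    refine (((t1.clog hω).sub (t2.clog hω')).div_const (s + 1)).congr' ?_
    filter_upwards [eventually_gt_atTop 0] with r hr
    have hrc : (r : ℂ) ≠ 0 := Complex.ofReal_ne_zero.mpr hr.ne'
    have e1 : (r : ℂ) * ω + 1 = (r : ℂ) * (ω + ((r⁻¹ : ℝ) : ℂ)) := by
      push_cast
      field_simp
    have e2 : s - r * ω = (r : ℂ) * (((r⁻¹ : ℝ) : ℂ) * s - ω) := by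
      push_cast
      field_simp
    have n1 := Complex.slitPlane_ne_zero (hadd r hr.le)
    have n2 := Complex.slitPlane_ne_zero (hsub r hr.le)
    rw [e1] at n1
    rw [e2] at n2
    rw [e1, e2, Complex.log_ofReal_mul hr (right_ne_zero_of_mul n1),
      Complex.log_ofReal_mul hr (right_ne_zero_of_mul n2)]
    ring
  rw [integral_Ioi_of_hasDerivAt_of_tendsto (hder 0 le_rfl).continuousAt.continuousWithinAt
    (fun r (hr : 0 < r) => hder r hr.le) ?_ hlim]
  · simp
    ring
  · exact integrableOn_div_sub_ray (by rw [hre]; linarith) (hB.continuousOn_ray hre hn)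
      (by norm_num) (by norm_num) (hB.norm_ray_le hre hn) hs

theorem log_sub_log_neg_of_im_pos {ω : ℂ} (h : 0 < ω.im) :
    Complex.log ω - Complex.log (-ω) = Real.pi * Complex.I := by
  rw [Complex.log, Complex.log, norm_neg, Complex.arg_neg_eq_arg_sub_pi_of_im_pos h]
  push_cast
  ring

theorem log_sub_log_neg_of_im_neg {ω : ℂ} (h : ω.im < 0) :
    Complex.log ω - Complex.log (-ω) = -(Real.pi * Complex.I) := by
  rw [Complex.log, Complex.log, norm_neg, Complex.arg_neg_eq_arg_add_pi_of_im_neg h]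
  push_cast
  ring

/-- The inverse Laplace integral of `F` over the boundary of `sector η`. -/
noncomputable def contourInverse (η : ℝ) (F : ℂ → ℂ) (t : ℝ) : ℂ :=
  (2 * Real.pi * Complex.I)⁻¹ * (rayIntegral (rayDir η) (fun r => F (r * rayDir η) * rayDir η) t -
    rayIntegral (rayDirConj η) (fun r => F (r * rayDirConj η) * rayDirConj η) t)

namespace SectorBound

variable {η q C : ℝ} {F : ℂ → ℂ}

/-- Cauchy's integral formula for the boundary of a sector. -/
theorem integral_div_sub_sub (h : SectorBound η q C F) (hη0 : 0 < η) (hη : η < 1)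
    (hq : -1 < q) (hq' : q < 0) {s : ℂ} (hs : 0 < s.re) :
    (∫ r in Ioi (0 : ℝ), F (r * rayDir η) * rayDir η / (s - r * rayDir η)) -
      ∫ r in Ioi (0 : ℝ), F (r * rayDirConj η) * rayDirConj η / (s - r * rayDirConj η) =
      2 * Real.pi * Complex.I * F s := by
  -- Chosen so that `F z - k / (z + 1)` vanishes at `s`. The factor `2πi` then comes from the jump
  -- `±πi` of `log ω - log (-ω)` between the rays.
  set k : ℂ := F s * (s + 1) with hk
  have hs1 : s + 1 ≠ 0 := fun h => by
    have := congrArg Complex.re h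
    simp at this
    linarith
  have hB := sectorBound_inv_add_one (q := q) hη0.le hη hq.le hq'.le
  have hM := h.sub (hB.const_mul k)
  have h0 := hM.integral_div_sub_eq_of_apply_eq_zero hη0 hη hq hq' hs (by
    rw [hk]; field_simp; simp)
  have hsplit : ∀ ω : ℂ, ω.re = -η → ‖ω‖ = 1 →
      ∫ r in Ioi (0 : ℝ), (F (r * ω) - k * (r * ω + 1)⁻¹) * ω / (s - r * ω) =
      (∫ r in Ioi (0 : ℝ), F (r * ω) * ω / (s - r * ω)) -
        k * ∫ r in Ioi (0 : ℝ), (r * ω + 1)⁻¹ * ω / (s - r * ω) := by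
    intro ω hre hn
    have hω : ω.re < 0 := by rw [hre]; linarith
    rw [← integral_const_mul, ← integral_sub
      (integrableOn_div_sub_ray hω (h.continuousOn_ray hre hn) hq hq' (h.norm_ray_le hre hn) hs)
      ((integrableOn_div_sub_ray hω (hB.continuousOn_ray hre hn) hq hq'
        (hB.norm_ray_le hre hn) hs).const_mul k)]
    congr 1
    funext r
    ring
  rw [hsplit _ (rayDir_re hη0 hη) (norm_rayDir η),
    hsplit _ (rayDirConj_re hη0 hη) (norm_rayDirConj η),
    integral_inv_add_one_div_sub hη0 hη (rayDir_re hη0 hη) (norm_rayDir η)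
      (rayDir_im hη0 hη).ne' hs,
    integral_inv_add_one_div_sub hη0 hη (rayDirConj_re hη0 hη) (norm_rayDirConj η)
      (rayDirConj_im hη0 hη).ne hs,
    log_sub_log_neg_of_im_pos (rayDir_im hη0 hη),
    log_sub_log_neg_of_im_neg (rayDirConj_im hη0 hη)] at h0
  have h1 := sub_eq_sub_iff_sub_eq_sub.mp h0
  rw [h1, hk]
  field_simp
  ring

theorem isInverseLaplace (h : SectorBound η q C F) (hη0 : 0 < η) (hη : η < 1)
    (hq : -1 < q) (hq' : q < 0) : IsInverseLaplace F (contourInverse η F) := by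
  have r₁ := rayDir_re hη0 hη
  have r₂ := rayDirConj_re hη0 hη
  have n₁ := norm_rayDir η
  have n₂ := norm_rayDirConj η
  have l₁ : (rayDir η).re < 0 := by rw [r₁]; linarith
  have l₂ : (rayDirConj η).re < 0 := by rw [r₂]; linarith
  have c₁ := h.continuousOn_ray r₁ n₁
  have c₂ := h.continuousOn_ray r₂ n₂
  have b₁ := h.norm_ray_le r₁ n₁
  have b₂ := h.norm_ray_le r₂ n₂
  refine ⟨continuousOn_const.mul ((continuousOn_rayIntegral l₁ c₁ hq b₁).sub
    (continuousOn_rayIntegral l₂ c₂ hq b₂)), 0, fun s hs => ?_⟩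
  have i₁ := integrableOn_laplace_rayIntegral l₁ c₁ hq hq' b₁ hs
  have i₂ := integrableOn_laplace_rayIntegral l₂ c₂ hq hq' b₂ hs
  have e : (fun t : ℝ => Complex.exp (-(s * (t : ℂ))) * contourInverse η F t) = fun t : ℝ =>
      (2 * Real.pi * Complex.I)⁻¹ * (Complex.exp (-(s * (t : ℂ))) *
        rayIntegral (rayDir η) (fun r => F (r * rayDir η) * rayDir η) t -
      Complex.exp (-(s * (t : ℂ))) *
        rayIntegral (rayDirConj η) (fun r => F (r * rayDirConj η) * rayDirConj η) t) := by
    funext t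
    rw [contourInverse]
    ring
  rw [e]
  refine ⟨(i₁.sub i₂).const_mul _, ?_⟩
  rw [integral_const_mul, integral_sub i₁ i₂, integral_laplace_rayIntegral l₁ c₁ hq hq' b₁ hs,
    integral_laplace_rayIntegral l₂ c₂ hq hq' b₂ hs, h.integral_div_sub_sub hη0 hη hq hq' hs,
    inv_mul_cancel_left₀ Complex.two_pi_I_ne_zero]

theorem norm_contourInverse_le (h : SectorBound η q C F) (hη0 : 0 < η) (hη : η < 1)
    (hq : -1 < q) : ∃ K, ∀ t, 0 < t → ‖contourInverse η F t‖ ≤ K * t ^ (-q - 1) := by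
  have r₁ := rayDir_re hη0 hη
  have r₂ := rayDirConj_re hη0 hη
  obtain ⟨K₁, hK₁⟩ := norm_rayIntegral_le (by rw [r₁]; linarith) hq
    (h.norm_ray_le r₁ (norm_rayDir η))
  obtain ⟨K₂, hK₂⟩ := norm_rayIntegral_le (by rw [r₂]; linarith) hq
    (h.norm_ray_le r₂ (norm_rayDirConj η))
  refine ⟨‖(2 * Real.pi * Complex.I : ℂ)⁻¹‖ * (K₁ + K₂), fun t ht => ?_⟩
  rw [contourInverse, norm_mul, mul_assoc ‖_‖, add_mul]
  gcongr
  exact (norm_sub_le _ _).trans (add_le_add (hK₁ t ht) (hK₂ t ht))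

end SectorBound

theorem norm_contourInverse_le_of_integrableOn {η : ℝ} (hη0 : 0 < η) (hη : η < 1) {F : ℂ → ℂ}
    {b : ℝ → ℝ} (hb : ∀ z ∈ sector η, ‖F z‖ ≤ b ‖z‖) (hbi : IntegrableOn b (Ioi 0)) :
    ∃ K, ∀ t, 0 < t → ‖contourInverse η F t‖ ≤ K := by
  have hb' : ∀ ω : ℂ, ω.re = -η → ‖ω‖ = 1 → ∀ r : ℝ, 0 < r → ‖F (r * ω) * ω‖ ≤ b r := by
    intro ω hre hn r hr
    have := hb _ (mul_mem_sector hre hn hr)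
    rwa [norm_mul (r : ℂ), hn, Complex.norm_real, Real.norm_of_nonneg hr.le, mul_one,
      ← mul_one ‖F _‖, ← hn, ← norm_mul] at this
  have r₁ := rayDir_re hη0 hη
  have r₂ := rayDirConj_re hη0 hη
  obtain ⟨K₁, hK₁⟩ := norm_rayIntegral_le_of_integrableOn (by rw [r₁]; linarith)
    (hb' _ r₁ (norm_rayDir η)) hbi
  obtain ⟨K₂, hK₂⟩ := norm_rayIntegral_le_of_integrableOn (by rw [r₂]; linarith)
    (hb' _ r₂ (norm_rayDirConj η)) hbi
  refine ⟨‖(2 * Real.pi * Complex.I : ℂ)⁻¹‖ * (K₁ + K₂), fun t ht => ?_⟩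
  rw [contourInverse, norm_mul]
  gcongr
  exact (norm_sub_le _ _).trans (add_le_add (hK₁ t ht) (hK₂ t ht))

/-- A constant does not contribute to the inverse Laplace integral. -/
theorem contourInverse_sub_const {η q C : ℝ} {F : ℂ → ℂ} (h : SectorBound η q C F) (hη0 : 0 < η)
    (hη : η < 1) (hq : -1 < q) (k : ℂ) {t : ℝ} (ht : 0 < t) :
    contourInverse η (fun z => F z - k) t = contourInverse η F t := by
  -- The constant adds `k / t` on each ray, independently of `ω`, so it cancels in the difference.
  have key : ∀ ω : ℂ, ω.re = -η → ‖ω‖ = 1 →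
      rayIntegral ω (fun r => (F (r * ω) - k) * ω) t =
        rayIntegral ω (fun r => F (r * ω) * ω) t + k / t := by
    intro ω hre hn
    have hω : ω.re < 0 := by rw [hre]; linarith
    have hω0 : ω ≠ 0 := fun h => by simp [h] at hn
    have hωt : (ω * t).re < 0 := by
      rw [Complex.re_mul_ofReal]
      exact mul_neg_of_neg_of_pos hω ht
    have e : ∀ r : ℝ, Complex.exp (ω * ((r : ℂ) * (t : ℂ))) * ((F (r * ω) - k) * ω) =
        Complex.exp (ω * ((r : ℂ) * (t : ℂ))) * (F (r * ω) * ω) -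
          Complex.exp (ω * t * r) * (k * ω) := by
      intro r
      rw [show ω * t * r = ω * ((r : ℂ) * (t : ℂ)) by ring]
      ring
    simp only [rayIntegral, e]
    rw [integral_sub (integrableOn_ray hω (h.continuousOn_ray hre hn) hq (h.norm_ray_le hre hn) ht)
      ((integrableOn_exp_mul_complex_Ioi hωt 0).mul_const _), integral_mul_const,
      integral_exp_mul_complex_Ioi hωt]
    have : (t : ℂ) ≠ 0 := Complex.ofReal_ne_zero.mpr ht.ne'
    simp only [Complex.ofReal_zero, mul_zero, Complex.exp_zero]
    rw [sub_eq_add_neg]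
    congr 1
    field_simp
  rw [contourInverse, contourInverse, key _ (rayDir_re hη0 hη) (norm_rayDir η),
    key _ (rayDirConj_re hη0 hη) (norm_rayDirConj η)]
  ring

/-! ### Lower bounds for `Q` and the resulting sector bounds -/

section CharQ

variable {α₁ α₂ : ℝ} {A : Matrix (Fin 2) (Fin 2) ℝ}

theorem continuousAt_charQ (hα₁ : 0 < α₁) (hα₂ : 0 < α₂) {z : ℂ} (hz : 0 ≤ z.re ∨ z.im ≠ 0) :
    ContinuousAt (charQ α₁ α₂ A) z := by
  have h : ∀ p : ℝ, 0 < p → ContinuousAt (fun x : ℂ => x ^ (p : ℂ)) z := fun p hp =>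
    Complex.continuousAt_cpow_const_of_re_pos hz (by simpa using hp)
  exact (((h _ (add_pos hα₁ hα₂)).sub (continuousAt_const.mul (h _ hα₂))).sub
    (continuousAt_const.mul (h _ hα₁))).add continuousAt_const

theorem norm_charQ_sub_det_le (z : ℂ) : ‖(A.det : ℂ) - charQ α₁ α₂ A z‖ ≤
    ‖z‖ ^ (α₁ + α₂) + |A 0 0| * ‖z‖ ^ α₂ + |A 1 1| * ‖z‖ ^ α₁ := by
  have e : (A.det : ℂ) - charQ α₁ α₂ A z = -z ^ ((α₁ + α₂ : ℝ) : ℂ) +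
      (A 0 0 : ℂ) * z ^ (α₂ : ℂ) + (A 1 1 : ℂ) * z ^ (α₁ : ℂ) := by
    rw [charQ]
    ring
  rw [e]
  refine (norm_add₃_le).trans (le_of_eq ?_)
  simp only [norm_neg, norm_mul, Complex.norm_cpow_real, Complex.norm_real, Real.norm_eq_abs]

theorem norm_charQ_ge (z : ℂ) : ‖z‖ ^ (α₁ + α₂) - |A 0 0| * ‖z‖ ^ α₂ - |A 1 1| * ‖z‖ ^ α₁
    - |A.det| ≤ ‖charQ α₁ α₂ A z‖ := by
  have e : z ^ ((α₁ + α₂ : ℝ) : ℂ) = charQ α₁ α₂ A z + ((A 0 0 : ℂ) * z ^ (α₂ : ℂ) +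
      (A 1 1 : ℂ) * z ^ (α₁ : ℂ) + -(A.det : ℂ)) := by
    rw [charQ]
    ring
  have h := norm_add_le (charQ α₁ α₂ A z) ((A 0 0 : ℂ) * z ^ (α₂ : ℂ) +
      (A 1 1 : ℂ) * z ^ (α₁ : ℂ) + -(A.det : ℂ))
  have h' := norm_add₃_le (a := (A 0 0 : ℂ) * z ^ (α₂ : ℂ))
    (b := (A 1 1 : ℂ) * z ^ (α₁ : ℂ)) (c := -(A.det : ℂ))
  rw [← e] at h
  simp only [norm_neg, norm_mul, Complex.norm_cpow_real, Complex.norm_real,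
    Real.norm_eq_abs] at h h'
  linarith

theorem exists_norm_charQ_ge_of_large (hα₁ : 0 < α₁) (hα₂ : 0 < α₂) :
    ∃ M : ℝ, 1 ≤ M ∧ ∀ z : ℂ, M ≤ ‖z‖ → 1 / 2 * ‖z‖ ^ (α₁ + α₂) ≤ ‖charQ α₁ α₂ A z‖ := by
  have hlim : Tendsto (fun r : ℝ => |A 0 0| * r ^ (-α₁) + |A 1 1| * r ^ (-α₂)
      + |A.det| * r ^ (-(α₁ + α₂))) atTop (𝓝 0) := by
    have := (((tendsto_rpow_neg_atTop hα₁).const_mul |A 0 0|).add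
      ((tendsto_rpow_neg_atTop hα₂).const_mul |A 1 1|)).add
      ((tendsto_rpow_neg_atTop (add_pos hα₁ hα₂)).const_mul |A.det|)
    simpa using this
  obtain ⟨M, hM⟩ := eventually_atTop.mp (hlim.eventually (gt_mem_nhds (by norm_num : (0:ℝ) < 1 / 2)))
  refine ⟨max M 1, le_max_right _ _, fun z hz => le_trans ?_ (norm_charQ_ge z)⟩
  have hr : 0 < ‖z‖ := by have := le_max_right M 1; linarith
  have h1 := hM ‖z‖ ((le_max_left _ _).trans hz)
  have hp := Real.rpow_pos_of_pos hr (α₁ + α₂)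
  have e1 : ‖z‖ ^ (-α₁) * ‖z‖ ^ (α₁ + α₂) = ‖z‖ ^ α₂ := by
    rw [← Real.rpow_add hr]; congr 1; ring
  have e2 : ‖z‖ ^ (-α₂) * ‖z‖ ^ (α₁ + α₂) = ‖z‖ ^ α₁ := by
    rw [← Real.rpow_add hr]; congr 1; ring
  have e3 : ‖z‖ ^ (-(α₁ + α₂)) * ‖z‖ ^ (α₁ + α₂) = 1 := by
    rw [← Real.rpow_add hr, neg_add_cancel, Real.rpow_zero]
  have h2 := mul_le_mul_of_nonneg_right h1.le hp.le
  rw [add_mul, add_mul, mul_assoc, mul_assoc, mul_assoc, e1, e2, e3] at h2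
  linarith

theorem exists_norm_charQ_ge (hα₁ : 0 < α₁) (hα₂ : 0 < α₂)
    (hQ : ∀ s : ℂ, 0 ≤ s.re → charQ α₁ α₂ A s ≠ 0) :
    ∃ η c : ℝ, 0 < η ∧ η < 1 ∧ 0 < c ∧ ∀ z ∈ sector η,
      c ≤ ‖charQ α₁ α₂ A z‖ ∧ c * ‖z‖ ^ (α₁ + α₂) ≤ ‖charQ α₁ α₂ A z‖ := by
  obtain ⟨M, hM1, hM⟩ := exists_norm_charQ_ge_of_large (A := A) hα₁ hα₂
  have hM0 : 0 < M := by linarith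
  set K : Set ℂ := Metric.closedBall 0 M ∩ {z | 0 ≤ z.re} with hK
  have hKc : IsCompact K := (isCompact_closedBall 0 M).inter_right
    (isClosed_le continuous_const Complex.continuous_re)
  have hcont : ∀ z ∈ K, ContinuousAt (fun z => ‖charQ α₁ α₂ A z‖) z := fun z hz =>
    (continuousAt_charQ hα₁ hα₂ (Or.inl hz.2)).norm
  obtain ⟨z₀, hz₀, hmin⟩ := hKc.exists_isMinOn ⟨0, by simp [hK, hM0.le]⟩
    (fun z hz => (hcont z hz).continuousWithinAt)
  set m := ‖charQ α₁ α₂ A z₀‖ with hm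
  have hm0 : 0 < m := norm_pos_iff.mpr (hQ z₀ hz₀.2)
  have hsub : K ⊆ interior {z | m / 2 < ‖charQ α₁ α₂ A z‖} := fun z hz =>
    mem_interior_iff_mem_nhds.mpr ((hcont z hz).eventually (lt_mem_nhds (by
      have : m ≤ ‖charQ α₁ α₂ A z‖ := hmin hz
      linarith)))
  obtain ⟨δ, hδ, hthick⟩ := hKc.exists_thickening_subset_open isOpen_interior hsub
  have hML : 0 < M ^ (α₁ + α₂) := Real.rpow_pos_of_pos hM0 _
  -- If `|z| ≤ M` and `Re z ≤ 0` in the sector, then `z` is within `η M ≤ δ / 2` of the imaginary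
  -- axis, hence in the thickening. Dividing by `M ^ (α₁ + α₂) ≥ 1` makes one `c` serve both bounds.
  refine ⟨min (1 / 2) (δ / (2 * M)), min (1 / 2) (m / 2 / M ^ (α₁ + α₂)), by positivity,
    (min_le_left _ _).trans_lt (by norm_num), by positivity, fun z hz => ?_⟩
  have hL : 0 ≤ α₁ + α₂ := by linarith
  rcases le_total M ‖z‖ with hzM | hzM
  · have h1 := hM z hzM
    have h2 : 1 ≤ ‖z‖ ^ (α₁ + α₂) := Real.one_le_rpow (hM1.trans hzM) hL
    have h3 : min (1 / 2) (m / 2 / M ^ (α₁ + α₂)) ≤ 1 / 2 := min_le_left _ _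
    constructor
    · linarith
    · exact le_trans (by gcongr) h1
  · have hmem : z ∈ Metric.thickening δ K := by
      rcases le_total 0 z.re with h0 | h0
      · exact Metric.self_subset_thickening hδ K ⟨by simpa using hzM, h0⟩
      · refine Metric.mem_thickening_iff.mpr ⟨z.im * Complex.I, ⟨?_, by simp⟩, ?_⟩
        · simpa using (Complex.abs_im_le_norm z).trans hzM
        · have e : z - z.im * Complex.I = (z.re : ℂ) := by
            rw [sub_eq_iff_eq_add, Complex.re_add_im]
          rw [dist_eq_norm, e, Complex.norm_real, Real.norm_of_nonpos h0]
          calc -z.re ≤ min (1 / 2) (δ / (2 * M)) * ‖z‖ := by linarith [hz.2]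
            _ ≤ δ / (2 * M) * M := by gcongr; exact min_le_right _ _
            _ < δ := by field_simp; linarith
    have h1 : m / 2 < ‖charQ α₁ α₂ A z‖ :=
      interior_subset (s := {z | m / 2 < ‖charQ α₁ α₂ A z‖}) (hthick hmem)
    have hML1 : 1 ≤ M ^ (α₁ + α₂) := Real.one_le_rpow hM1 hL
    have h2 : min (1 / 2) (m / 2 / M ^ (α₁ + α₂)) ≤ m / 2 / M ^ (α₁ + α₂) := min_le_right _ _
    constructor
    · exact h2.trans ((div_le_self (by positivity) hML1).trans h1.le)
    · calc _ ≤ m / 2 / M ^ (α₁ + α₂) * M ^ (α₁ + α₂) := by gcongr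
        _ = m / 2 := by field_simp
        _ ≤ _ := h1.le

variable {η c : ℝ}

/-- Division by `Q` may lower the exponent by anything from `0` to `α₁ + α₂`: the constant bound is
used for `|z| ≤ 1`, the growth bound for `|z| ≥ 1`. -/
theorem rpow_div_norm_charQ_le (hc : 0 < c) {z : ℂ} (hz : z ≠ 0)
    (hb : c ≤ ‖charQ α₁ α₂ A z‖ ∧ c * ‖z‖ ^ (α₁ + α₂) ≤ ‖charQ α₁ α₂ A z‖) {p q : ℝ}
    (hqp : q ≤ p) (hpq : p ≤ q + (α₁ + α₂)) :
    ‖z‖ ^ p / ‖charQ α₁ α₂ A z‖ ≤ c⁻¹ * ‖z‖ ^ q := by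
  have hr : 0 < ‖z‖ := norm_pos_iff.mpr hz
  have hq0 := Real.rpow_pos_of_pos hr q
  rw [div_le_iff₀ (hc.trans_le hb.1), inv_mul_eq_div, div_mul_eq_mul_div, le_div_iff₀ hc]
  rcases le_total ‖z‖ 1 with h | h
  · calc ‖z‖ ^ p * c ≤ ‖z‖ ^ q * c := by
          gcongr ?_ * _
          exact Real.rpow_le_rpow_of_exponent_ge hr h hqp
      _ ≤ _ := by gcongr; exact hb.1
  · calc ‖z‖ ^ p * c ≤ ‖z‖ ^ (q + (α₁ + α₂)) * c := by gcongr
      _ = ‖z‖ ^ q * (c * ‖z‖ ^ (α₁ + α₂)) := by rw [Real.rpow_add hr]; ring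
      _ ≤ _ := by gcongr; exact hb.2

theorem differentiableAt_cpow_ofReal {z : ℂ} (hz : z ∈ Complex.slitPlane) (p : ℝ) :
    DifferentiableAt ℂ (fun x : ℂ => x ^ (p : ℂ)) z :=
  differentiableAt_id.cpow (differentiableAt_const _) hz

theorem differentiableAt_charQ {z : ℂ} (hz : z ∈ Complex.slitPlane) :
    DifferentiableAt ℂ (charQ α₁ α₂ A) z :=
  (((differentiableAt_cpow_ofReal hz _).sub ((differentiableAt_cpow_ofReal hz _).const_mul _)).sub
    ((differentiableAt_cpow_ofReal hz _).const_mul _)).add_const _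

theorem charQ_ne_zero_of_mem_sector (hc : 0 < c)
    (hb : ∀ z ∈ sector η,
      c ≤ ‖charQ α₁ α₂ A z‖ ∧ c * ‖z‖ ^ (α₁ + α₂) ≤ ‖charQ α₁ α₂ A z‖) {z : ℂ}
    (hz : z ∈ sector η) : charQ α₁ α₂ A z ≠ 0 :=
  norm_pos_iff.mp (hc.trans_le (hb z hz).1)

section Images

variable (hη : η < 1) (hc : 0 < c)
  (hb : ∀ z ∈ sector η,
    c ≤ ‖charQ α₁ α₂ A z‖ ∧ c * ‖z‖ ^ (α₁ + α₂) ≤ ‖charQ α₁ α₂ A z‖)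
include hη hc hb

theorem sectorBound_imageS {β q : ℝ} (hq : -β ≤ q) (hq' : q ≤ α₁ + α₂ - β) :
    SectorBound η q c⁻¹ (imageS α₁ α₂ A β) := by
  refine ⟨fun z hz => ?_, fun z hz => ?_⟩
  · exact (differentiableAt_cpow_ofReal (sector_subset_slitPlane hη hz) _).div
      (differentiableAt_charQ (sector_subset_slitPlane hη hz))
      (charQ_ne_zero_of_mem_sector hc hb hz)
  · rw [imageS, norm_div, Complex.norm_cpow_real]
    exact rpow_div_norm_charQ_le hc hz.1 (hb z hz) hq' (by linarith)

theorem sectorBound_imageR {lam q : ℝ} (hq : -lam - 1 ≤ q) (hq' : q ≤ α₁ + α₂ - lam - 1) :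
    SectorBound η q c⁻¹ (imageR α₁ α₂ A lam) := by
  refine ⟨fun z hz => ?_, fun z hz => ?_⟩
  · exact (differentiableAt_cpow_ofReal (sector_subset_slitPlane hη hz) _).div
      (differentiableAt_id.mul (differentiableAt_charQ (sector_subset_slitPlane hη hz)))
      (mul_ne_zero hz.1 (charQ_ne_zero_of_mem_sector hc hb hz))
  · have hz0 : ‖z‖ ≠ 0 := norm_ne_zero_iff.mpr hz.1
    rw [imageR, norm_div, norm_mul, Complex.norm_cpow_real, ← div_div, ← Real.rpow_sub_one hz0]
    exact rpow_div_norm_charQ_le hc hz.1 (hb z hz) hq' (by linarith)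

/-- `1/Q - 1/det A = (det A - Q) / (Q det A)`, and the lowest power of `|z|` in the numerator bound
is at least `ν`. -/
theorem sectorBound_imageS_sub_det (hα₁ : 0 < α₁) (hα₂ : 0 < α₂) (hdet : A.det ≠ 0) :
    ∃ C, SectorBound η (min α₁ α₂) C
      (fun z => imageS α₁ α₂ A (α₁ + α₂) z - (A.det : ℂ)⁻¹) := by
  refine ⟨|A.det|⁻¹ * (c⁻¹ + |A 0 0| * c⁻¹ + |A 1 1| * c⁻¹), fun z hz => ?_, fun z hz => ?_⟩
  · exact ((sectorBound_imageS hη hc hb (q := 0) (by linarith) (by linarith)).differentiableAt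
      z hz).sub_const _
  · have hQ := charQ_ne_zero_of_mem_sector hc hb hz
    have hd : (A.det : ℂ) ≠ 0 := Complex.ofReal_ne_zero.mpr hdet
    have e : imageS α₁ α₂ A (α₁ + α₂) z - (A.det : ℂ)⁻¹ =
        (A.det : ℂ)⁻¹ * (((A.det : ℂ) - charQ α₁ α₂ A z) / charQ α₁ α₂ A z) := by
      rw [imageS, sub_self, Complex.ofReal_zero, Complex.cpow_zero]
      field_simp
    rw [e, norm_mul, norm_inv, Complex.norm_real, Real.norm_eq_abs, norm_div, mul_assoc]
    gcongr
    have key := fun p hp hp' => rpow_div_norm_charQ_le (p := p) (q := min α₁ α₂) hc hz.1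
      (hb z hz) hp hp'
    have hm1 := min_le_left α₁ α₂
    have hm2 := min_le_right α₁ α₂
    have hm : 0 < min α₁ α₂ := lt_min hα₁ hα₂
    have k1 := key (α₁ + α₂) (by linarith) (by linarith)
    have k2 := key α₂ hm2 (by linarith)
    have k3 := key α₁ hm1 (by linarith)
    calc ‖(A.det : ℂ) - charQ α₁ α₂ A z‖ / ‖charQ α₁ α₂ A z‖
        ≤ (‖z‖ ^ (α₁ + α₂) + |A 0 0| * ‖z‖ ^ α₂ + |A 1 1| * ‖z‖ ^ α₁) / ‖charQ α₁ α₂ A z‖ := by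
          gcongr
          exact norm_charQ_sub_det_le z
      _ = ‖z‖ ^ (α₁ + α₂) / ‖charQ α₁ α₂ A z‖ + |A 0 0| * (‖z‖ ^ α₂ / ‖charQ α₁ α₂ A z‖)
          + |A 1 1| * (‖z‖ ^ α₁ / ‖charQ α₁ α₂ A z‖) := by ring
      _ ≤ c⁻¹ * ‖z‖ ^ min α₁ α₂ + |A 0 0| * (c⁻¹ * ‖z‖ ^ min α₁ α₂)
          + |A 1 1| * (c⁻¹ * ‖z‖ ^ min α₁ α₂) := by gcongr
      _ = _ := by ring

end Images

end CharQ

theorem charQ_zero {α₁ α₂ : ℝ} (hα₁ : 0 < α₁) (hα₂ : 0 < α₂) (A : Matrix (Fin 2) (Fin 2) ℝ) :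
    charQ α₁ α₂ A 0 = (A.det : ℂ) := by
  have h : ∀ p : ℝ, 0 < p → (0 : ℂ) ^ (p : ℂ) = 0 := fun p hp =>
    Complex.zero_cpow (Complex.ofReal_ne_zero.mpr hp.ne')
  rw [charQ, h _ (add_pos hα₁ hα₂), h _ hα₁, h _ hα₂]
  ring

/-! ### Sums, the transform of `exp (-t)`, and consequences of power bounds -/

theorem IsInverseLaplace.add {F G : ℂ → ℂ} {f g : ℝ → ℂ} (hf : IsInverseLaplace F f)
    (hg : IsInverseLaplace G g) :
    IsInverseLaplace (fun s => F s + G s) (fun t => f t + g t) := by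
  obtain ⟨hfc, σ₁, h₁⟩ := hf
  obtain ⟨hgc, σ₂, h₂⟩ := hg
  refine ⟨hfc.add hgc, max σ₁ σ₂, fun s hs => ?_⟩
  obtain ⟨i₁, e₁⟩ := h₁ s ((le_max_left _ _).trans_lt hs)
  obtain ⟨i₂, e₂⟩ := h₂ s ((le_max_right _ _).trans_lt hs)
  simp only [mul_add]
  exact ⟨i₁.add i₂, by rw [integral_add i₁ i₂, e₁, e₂]⟩

theorem isInverseLaplace_exp_neg :
    IsInverseLaplace (fun s => (s + 1)⁻¹) (fun t : ℝ => Complex.exp (-(t : ℂ))) := by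
  refine ⟨Continuous.continuousOn (by fun_prop), -1, fun s hs => ?_⟩
  have hre : (-(s + 1)).re < 0 := by
    simp
    linarith
  have e : (fun t : ℝ => Complex.exp (-(s * (t : ℂ))) * Complex.exp (-(t : ℂ))) =
      fun t : ℝ => Complex.exp (-(s + 1) * t) := by
    funext t
    rw [← Complex.exp_add]
    congr 1
    ring
  rw [e]
  refine ⟨integrableOn_exp_mul_complex_Ioi hre 0, ?_⟩
  rw [integral_exp_mul_complex_Ioi hre, Complex.ofReal_zero, mul_zero, Complex.exp_zero,
    neg_div_neg_eq, one_div]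

theorem isBigO_of_norm_le {g : ℝ → ℂ} {K p : ℝ} (h : ∀ t, 0 < t → ‖g t‖ ≤ K * t ^ p)
    {l : Filter ℝ} (hl : ∀ᶠ t in l, 0 < t) : g =O[l] fun t : ℝ => t ^ p := by
  refine IsBigO.of_bound K ?_
  filter_upwards [hl] with t ht
  rw [Real.norm_of_nonneg (Real.rpow_nonneg ht.le p)]
  exact h t ht

theorem integrableOn_Ioi_of_norm_le {g : ℝ → ℂ} (hg : ContinuousOn g (Ioi 0)) {K K' p p' : ℝ}
    (hp : -1 < p) (hp' : p' < -1) (h : ∀ t, 0 < t → ‖g t‖ ≤ K * t ^ p)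
    (h' : ∀ t, 0 < t → ‖g t‖ ≤ K' * t ^ p') : IntegrableOn g (Ioi 0) := by
  rw [← Ioc_union_Ioi_eq_Ioi (zero_le_one (α := ℝ)), integrableOn_union]
  constructor
  · have hi := (intervalIntegral.intervalIntegrable_rpow' (a := 0) (b := 1) hp)
    rw [intervalIntegrable_iff_integrableOn_Ioc_of_le zero_le_one] at hi
    refine Integrable.mono' (hi.const_mul K)
      ((hg.mono fun x hx => hx.1).aestronglyMeasurable measurableSet_Ioc) ?_
    exact (ae_restrict_iff' measurableSet_Ioc).mpr (ae_of_all _ fun r hr => h r hr.1)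
  · refine Integrable.mono' ((integrableOn_Ioi_rpow_of_lt hp' one_pos).const_mul K')
      ((hg.mono fun x (hx : 1 < x) => one_pos.trans hx).aestronglyMeasurable measurableSet_Ioi) ?_
    exact (ae_restrict_iff' measurableSet_Ioi).mpr
      (ae_of_all _ fun r (hr : 1 < r) => h' r (one_pos.trans hr))

/-! ### Existence, and decay at infinity -/

section Bounds

variable {α₁ α₂ η c : ℝ} {A : Matrix (Fin 2) (Fin 2) ℝ} (hη0 : 0 < η) (hη : η < 1) (hc : 0 < c)
  (hb : ∀ z ∈ sector η,
    c ≤ ‖charQ α₁ α₂ A z‖ ∧ c * ‖z‖ ^ (α₁ + α₂) ≤ ‖charQ α₁ α₂ A z‖)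
include hη0 hη hc hb

theorem exists_norm_le_of_isInverseLaplace_imageR (hα₁ : 0 < α₁) (hα₂ : 0 < α₂) {lam : ℝ}
    (h0 : 0 ≤ lam) (h1 : lam ≤ α₁ + α₂ - min α₁ α₂) (hν : min α₁ α₂ ≤ 1) :
    (∃ R, IsInverseLaplace (imageR α₁ α₂ A lam) R) ∧
    ∀ R, IsInverseLaplace (imageR α₁ α₂ A lam) R →
      ∃ K, ∀ t, 0 < t → ‖R t‖ ≤ K * t ^ (-(min α₁ α₂)) := by
  have hm : 0 < min α₁ α₂ := lt_min hα₁ hα₂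
  -- The exponent `ν - 1` of the decay estimate is `0` when `ν = 1`, so inversion uses `ν / 2 - 1`,
  -- which always lies in `(-1, 0)`.
  have hinv := (sectorBound_imageR hη hc hb (lam := lam) (q := min α₁ α₂ / 2 - 1) (by linarith)
    (by linarith)).isInverseLaplace hη0 hη (by linarith) (by linarith)
  refine ⟨⟨_, hinv⟩, fun R hR => ?_⟩
  obtain ⟨K, hK⟩ := (sectorBound_imageR hη hc hb (lam := lam) (q := min α₁ α₂ - 1) (by linarith)
    (by linarith)).norm_contourInverse_le hη0 hη (by linarith)
  refine ⟨K, fun t ht => ?_⟩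
  rw [hR.eqOn hinv ht, show -(min α₁ α₂) = -(min α₁ α₂ - 1) - 1 by ring]
  exact hK t ht

theorem isInverseLaplace_imageS (hα₁ : 0 < α₁) (hα₂ : 0 < α₂) {β : ℝ} (hβ : min α₁ α₂ ≤ β)
    (hβ' : β ≤ α₁ + α₂) (hν : min α₁ α₂ ≤ 1) :
    IsInverseLaplace (imageS α₁ α₂ A β) (contourInverse η (imageS α₁ α₂ A β)) := by
  have hm : 0 < min α₁ α₂ := lt_min hα₁ hα₂
  -- Halving keeps the exponent above `-1` even when `ν = 1`.
  exact (sectorBound_imageS hη hc hb (β := β) (q := -(min α₁ α₂ / 2)) (by linarith)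
    (by linarith)).isInverseLaplace hη0 hη (by linarith) (by linarith)

theorem norm_contourInverse_imageS_le_large (hα₁ : 0 < α₁) (hα₂ : 0 < α₂) (hdet : A.det ≠ 0)
    {β : ℝ} (hβ : β ∈ ({α₁, α₂, α₁ + α₂} : Set ℝ)) :
    ∃ K, ∀ t, 0 < t → ‖contourInverse η (imageS α₁ α₂ A β) t‖ ≤ K * t ^ (-(min α₁ α₂) - 1) := by
  have hm : 0 < min α₁ α₂ := lt_min hα₁ hα₂
  have hm1 := min_le_left α₁ α₂
  have hm2 := min_le_right α₁ α₂
  have hsmall : ∀ β : ℝ, 0 ≤ β → min α₁ α₂ ≤ α₁ + α₂ - β → ∃ K, ∀ t, 0 < t →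
      ‖contourInverse η (imageS α₁ α₂ A β) t‖ ≤ K * t ^ (-(min α₁ α₂) - 1) := fun β h0 h1 =>
    (sectorBound_imageS hη hc hb (by linarith) h1).norm_contourInverse_le hη0 hη (by linarith)
  rcases hβ with rfl | rfl | rfl
  · exact hsmall _ hα₁.le (by linarith)
  · exact hsmall _ hα₂.le (by linarith)
  · obtain ⟨C, hC⟩ := sectorBound_imageS_sub_det hη hc hb hα₁ hα₂ hdet
    obtain ⟨K, hK⟩ := hC.norm_contourInverse_le hη0 hη (by linarith)
    refine ⟨K, fun t ht => ?_⟩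
    have h0 := sectorBound_imageS hη hc hb (β := α₁ + α₂) (q := 0) (by linarith) (by linarith)
    rw [← contourInverse_sub_const h0 hη0 hη (by norm_num) (A.det : ℂ)⁻¹ ht]
    exact hK t ht

end Bounds

/-! ### Boundedness when both orders equal one -/

section OrderOne

variable {η c : ℝ} {A : Matrix (Fin 2) (Fin 2) ℝ} (hη0 : 0 < η) (hη : η < 1) (hc : 0 < c)
  (hb : ∀ z ∈ sector η,
    c ≤ ‖charQ 1 1 A z‖ ∧ c * ‖z‖ ^ ((1 : ℝ) + 1) ≤ ‖charQ 1 1 A z‖)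
include hη0 hη hc hb

omit hη0 hη hc in
theorem norm_charQ_one_ge {z : ℂ} (hz : z ∈ sector η) :
    c / 2 * (1 + ‖z‖ ^ 2) ≤ ‖charQ 1 1 A z‖ := by
  obtain ⟨h1, h2⟩ := hb z hz
  rw [one_add_one_eq_two, Real.rpow_two] at h2
  linarith

theorem norm_inverse_imageS_two_le : ∃ K, ∀ t, 0 < t →
    ‖contourInverse η (imageS 1 1 A (1 + 1)) t‖ ≤ K := by
  refine norm_contourInverse_le_of_integrableOn hη0 hη
    (b := fun r => (c / 2)⁻¹ * (1 + r ^ 2)⁻¹) (fun z hz => ?_)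
    (integrable_inv_one_add_sq.const_mul _).integrableOn
  rw [imageS, sub_self, Complex.ofReal_zero, Complex.cpow_zero, one_div, norm_inv, ← mul_inv]
  have := norm_charQ_one_ge hb hz
  gcongr

/-- `z / Q` is only `O(1/|z|)` at infinity. Removing `1 / (z + 1)` cancels the `z²` term of the
numerator and leaves `O(1 / (1 + |z|²))`, integrable on the rays; the removed part inverts to `exp
(-t)`. -/
theorem norm_inverse_imageS_one_le {S : ℝ → ℂ} (hS : IsInverseLaplace (imageS 1 1 A 1) S) :
    ∃ K, ∀ t, 0 < t → ‖S t‖ ≤ K := by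
  have hinv := ((sectorBound_imageS hη hc hb (β := 1) (q := -(1 / 2)) (by norm_num)
    (by norm_num)).sub (sectorBound_inv_add_one hη0.le hη (by norm_num)
    (by norm_num))).isInverseLaplace hη0 hη (by norm_num) (by norm_num)
  have hadd := hinv.add isInverseLaplace_exp_neg
  simp only [sub_add_cancel] at hadd
  set D : ℝ := ‖(1 + A 0 0 + A 1 1 : ℂ)‖ + ‖(A.det : ℂ)‖ with hD
  have hk : 0 < (1 - η) / 2 := by linarith
  obtain ⟨K, hK⟩ := norm_contourInverse_le_of_integrableOn hη0 hη
    (F := fun z => imageS 1 1 A 1 z - (z + 1)⁻¹)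
    (b := fun r => D / (c / 2 * ((1 - η) / 2)) * (1 + r ^ 2)⁻¹) (fun z hz => by
      have h1 := norm_charQ_one_ge hb hz
      have h2 := norm_add_one_ge hη0.le hη hz
      have h3 := charQ_ne_zero_of_mem_sector hc hb hz
      have h4 : z + 1 ≠ 0 := norm_pos_iff.mp ((mul_pos hk (by positivity)).trans_le h2)
      have e : imageS 1 1 A 1 z - (z + 1)⁻¹ =
          ((1 + A 0 0 + A 1 1) * z - A.det) / (charQ 1 1 A z * (z + 1)) := by
        rw [imageS, eq_div_iff (mul_ne_zero h3 h4), sub_mul]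
        have e1 : z ^ ((1 + 1 - 1 : ℝ) : ℂ) / charQ 1 1 A z * (charQ 1 1 A z * (z + 1)) =
            z * (z + 1) := by
          rw [add_sub_cancel_right, Complex.ofReal_one, Complex.cpow_one]
          field_simp
        have e2 : (z + 1)⁻¹ * (charQ 1 1 A z * (z + 1)) = charQ 1 1 A z := by
          field_simp
        have e3 : z ^ ((1 + 1 : ℝ) : ℂ) = z ^ 2 := by
          rw [one_add_one_eq_two, Complex.ofReal_ofNat, Complex.cpow_ofNat]
        rw [e1, e2, charQ, e3, Complex.ofReal_one, Complex.cpow_one]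
        ring
      have h5 : ‖(1 + A 0 0 + A 1 1) * z - A.det‖ ≤ D * (1 + ‖z‖) := by
        refine (norm_sub_le _ _).trans ?_
        rw [norm_mul, hD]
        have := mul_nonneg (norm_nonneg (A.det : ℂ)) (norm_nonneg z)
        have := norm_nonneg (1 + A 0 0 + A 1 1 : ℂ)
        nlinarith
      have h6 : 0 ≤ D := by positivity
      rw [e, norm_div, norm_mul]
      calc _ ≤ D * (1 + ‖z‖) / (c / 2 * (1 + ‖z‖ ^ 2) * ((1 - η) / 2 * (1 + ‖z‖))) := by
            gcongr
        _ = _ := by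
            have : 1 + ‖z‖ ≠ 0 := by positivity
            have : 1 + ‖z‖ ^ 2 ≠ 0 := by positivity
            have : 1 - η ≠ 0 := by linarith
            field_simp)
    (integrable_inv_one_add_sq.const_mul _).integrableOn
  refine ⟨K + 1, fun t ht => ?_⟩
  rw [hS.eqOn hadd ht]
  refine (norm_add_le _ _).trans (add_le_add (hK t ht) ?_)
  rw [Complex.norm_exp]
  simpa using ht.le

end OrderOne

/-! ### Behaviour at zero and conclusion -/

theorem exists_norm_le_rpow_of_isInverseLaplace_imageS {α₁ α₂ η c : ℝ}
    {A : Matrix (Fin 2) (Fin 2) ℝ} (hα₁ : α₁ ∈ Ioc (0 : ℝ) 1) (hα₂ : α₂ ∈ Ioc (0 : ℝ) 1)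
    (hη0 : 0 < η) (hη : η < 1) (hc : 0 < c)
    (hb : ∀ z ∈ sector η,
      c ≤ ‖charQ α₁ α₂ A z‖ ∧ c * ‖z‖ ^ (α₁ + α₂) ≤ ‖charQ α₁ α₂ A z‖)
    {β : ℝ} (hβ : β ∈ ({α₁, α₂, α₁ + α₂} : Set ℝ)) {S : ℝ → ℂ}
    (hS : IsInverseLaplace (imageS α₁ α₂ A β) S)
    (hinv : IsInverseLaplace (imageS α₁ α₂ A β) (contourInverse η (imageS α₁ α₂ A β))) :
    ∃ K, ∀ t, 0 < t → ‖S t‖ ≤ K * t ^ (min α₁ α₂ - 1) := by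
  have hm1 := min_le_left α₁ α₂
  have hm2 := min_le_right α₁ α₂
  -- The exponent `q = -ν` exceeds `-1` exactly when `ν < 1`; otherwise both orders are `1`.
  rcases lt_or_ge (min α₁ α₂) 1 with hν | hν
  · have hrange : min α₁ α₂ ≤ β ∧ β ≤ α₁ + α₂ := by
      have h1 := hα₁.1
      have h2 := hα₂.1
      rcases hβ with rfl | rfl | rfl <;> constructor <;> linarith
    have hm : 0 < min α₁ α₂ := lt_min hα₁.1 hα₂.1
    obtain ⟨K, hK⟩ := (sectorBound_imageS hη hc hb (β := β) (q := -(min α₁ α₂)) (by linarith)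
      (by linarith)).norm_contourInverse_le hη0 hη (by linarith)
    refine ⟨K, fun t ht => ?_⟩
    rw [hS.eqOn hinv ht]
    simpa using hK t ht
  · obtain rfl : α₁ = 1 := le_antisymm hα₁.2 (hν.trans hm1)
    obtain rfl : α₂ = 1 := le_antisymm hα₂.2 (hν.trans hm2)
    simp only [min_self, sub_self, Real.rpow_zero, mul_one]
    have hone : β = 1 → ∃ K, ∀ t, 0 < t → ‖S t‖ ≤ K := by
      rintro rfl
      exact norm_inverse_imageS_one_le hη0 hη hc hb hS
    rcases hβ with h | h | rfl
    · exact hone h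
    · exact hone h
    · obtain ⟨K, hK⟩ := norm_inverse_imageS_two_le hη0 hη hc hb
      refine ⟨K, fun t ht => ?_⟩
      rw [hS.eqOn hinv ht]
      exact hK t ht

theorem lemma4p1 (α₁ α₂ : ℝ) (hα₁ : α₁ ∈ Ioc (0 : ℝ) 1) (hα₂ : α₂ ∈ Ioc (0 : ℝ) 1)
    (A : Matrix (Fin 2) (Fin 2) ℝ)
    (hQ : ∀ s : ℂ, 0 ≤ s.re → charQ α₁ α₂ A s ≠ 0) :
    (∀ lam ∈ ({0, α₁, α₂} : Set ℝ),
      (∃ R : ℝ → ℂ, IsInverseLaplace (imageR α₁ α₂ A lam) R) ∧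
      ∀ R : ℝ → ℂ, IsInverseLaplace (imageR α₁ α₂ A lam) R →
        R =O[atTop] (fun t : ℝ => t ^ (-(min α₁ α₂)))) ∧
    (∀ β ∈ ({α₁, α₂, α₁ + α₂} : Set ℝ),
      (∃ S : ℝ → ℂ, IsInverseLaplace (imageS α₁ α₂ A β) S) ∧
      ∀ S : ℝ → ℂ, IsInverseLaplace (imageS α₁ α₂ A β) S →
        S =O[atTop] (fun t : ℝ => t ^ (-(min α₁ α₂) - 1)) ∧
        S =O[𝓝[>] (0 : ℝ)] (fun t : ℝ => t ^ (min α₁ α₂ - 1)) ∧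
        IntegrableOn S (Ioi 0)) := by
  have h1 := hα₁.1
  have h2 := hα₂.1
  have hm1 := min_le_left α₁ α₂
  have hm2 := min_le_right α₁ α₂
  have hm : 0 < min α₁ α₂ := lt_min h1 h2
  have hν : min α₁ α₂ ≤ 1 := hm1.trans hα₁.2
  have hdet : A.det ≠ 0 := by
    have := hQ 0 le_rfl
    rw [charQ_zero h1 h2] at this
    exact Complex.ofReal_ne_zero.mp this
  obtain ⟨η, c, hη0, hη, hc, hb⟩ := exists_norm_charQ_ge h1 h2 hQ
  refine ⟨fun lam hlam => ?_, fun β hβ => ?_⟩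
  · have hrange : 0 ≤ lam ∧ lam ≤ α₁ + α₂ - min α₁ α₂ := by
      rcases hlam with rfl | rfl | rfl <;> constructor <;> linarith
    obtain ⟨hex, hdecay⟩ := exists_norm_le_of_isInverseLaplace_imageR hη0 hη hc hb h1 h2
      hrange.1 hrange.2 hν
    refine ⟨hex, fun R hR => ?_⟩
    obtain ⟨K, hK⟩ := hdecay R hR
    exact isBigO_of_norm_le hK (eventually_gt_atTop 0)
  · have hrange : min α₁ α₂ ≤ β ∧ β ≤ α₁ + α₂ := by
      rcases hβ with rfl | rfl | rfl <;> constructor <;> linarith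
    have hinv := isInverseLaplace_imageS hη0 hη hc hb h1 h2 hrange.1 hrange.2 hν
    refine ⟨⟨_, hinv⟩, fun S hS => ?_⟩
    obtain ⟨K, hK⟩ := norm_contourInverse_imageS_le_large hη0 hη hc hb h1 h2 hdet hβ
    have hK' : ∀ t, 0 < t → ‖S t‖ ≤ K * t ^ (-(min α₁ α₂) - 1) := fun t ht => by
      rw [hS.eqOn hinv ht]
      exact hK t ht
    obtain ⟨L, hL⟩ := exists_norm_le_rpow_of_isInverseLaplace_imageS hα₁ hα₂ hη0 hη hc hb hβ hS
      hinv
    exact ⟨isBigO_of_norm_le hK' (eventually_gt_atTop 0),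
      isBigO_of_norm_le hL (eventually_mem_nhdsWithin),
      integrableOn_Ioi_of_norm_le hS.1 (by linarith) (by linarith) hL hK'⟩
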